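/- \textbf{Theorem (Akçoglu–Sucheston).} Let $1\le p<\infty$, let $(\Omega,\mu)$ be an arbitrary measure space, let $E=L^p(\Omega,\mu)$ with real or complex scalars, and let $T:E\to E$ be a positive linear contraction, i.e. $T$ is linear, $\|T\|\le 1$, and $Tf\ge 0$ whenever $f\ge 0$ almost everywhere. Then there exist a measure space $(\Omega',\mu')$ and, writing $\tilde E=L^p(\Omega',\mu')$ (with the same scalars), \begin{itemize} \item a positive, linear, invertible isometry $S:\tilde E\to\tilde E$, \item a positive linear isometric embedding $D:E\to\tilde E$, \item a positive linear projection $P:\tilde E\to\tilde E$ ($P^2=P$) with $\|P\|\le 1$, \end{itemize} such that \[ D\,T^k = P\,S^k\,D \qquad\text{for all } k=0,1,2,\ldots \] -/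

import Mathlib

open MeasureTheory
open scoped ENNReal

universe u

/-- An element of `L^p(Ω, μ; 𝕜)`, `𝕜 = ℝ` or `ℂ`, is nonnegative if its values are real and
nonnegative almost everywhere. -/
def LpNonneg {𝕜 : Type*} [RCLike 𝕜] {Ω : Type*} [MeasurableSpace Ω] {μ : Measure Ω} {p : ℝ≥0∞}
    (f : Lp 𝕜 p μ) : Prop :=
  ∀ᵐ x ∂μ, 0 ≤ RCLike.re (f x) ∧ RCLike.im (f x) = 0

/-- A map between `L^p`-spaces is positive if it maps nonnegative elements to nonnegative
elements. (It is used below for linear maps only.) -/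
def LpPositive {𝕜 : Type*} [RCLike 𝕜] {Ω Ω' : Type*} [MeasurableSpace Ω] [MeasurableSpace Ω']
    {μ : Measure Ω} {ν : Measure Ω'} {p : ℝ≥0∞} (T : Lp 𝕜 p μ → Lp 𝕜 p ν) : Prop :=
  ∀ f : Lp 𝕜 p μ, LpNonneg f → LpNonneg (T f)

/-!
The dilation is built from finite-dimensional models by an ultraproduct, so that neither the
exponent nor the measure space needs a separate treatment.

*Finite-dimensional models.* A nonnegative matrix `t` that strictly contracts the `ℓ^q`-norm has a
strictly positive vector `u` with `tᵀ (t u)^(q-1) ≤ u^(q-1)` (`exists_pos_superinvariant`). The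
vectors `u` and `t u` turn `t` into a weighted Markov chain. Its trajectories over a finite time
window, with births making up for missing mass, form a finite path space, whose marginal embeddings
compress to the powers of `t` (`exists_pathSpace`). On pairs of a trajectory and a uniformly
distributed time, the cyclic shift of time is a permutation of finitely many points, and its
compression by the conditional expectation onto the current state is, in the `k`-th power, `t^k` up
to an error `O(k / N)` caused by the times at which the shift wraps around
(`exists_finite_dilation`).

*From `L^p` to finite dimension.* Averaging over the atoms of finitely generated algebras of sets
gives positive contractions that factor through finite-dimensional `ℓ^p` spaces and converge
strongly to the identity (`exists_discretization`, `tendsto_of_fix_indicators`). A positive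
contraction of `L^p` therefore has approximate dilations on finite-dimensional `ℓ^p` spaces
(`exists_approx_dilation`), which become exact on an ultraproduct of these spaces
(`exists_ultraLp_dilation`).

*Representation of the ultraproduct.* The ultraproduct is again an `L^p` space, in an
order-preserving way (`exists_lp_equiv_ultraLp`). To see this, choose a maximal family `e` of
nonnegative classes with pairwise asymptotically disjoint supports
(`exists_maximal_asympDisjoint`). For each `a`, the limit of `∑ φ e_a^p` over the factors, along the
ultrafilter, is a positive functional of the bounded function `φ` on the disjoint union of the index
sets, that is, of a continuous function on the Stone–Čech compactification. The
Riesz–Markov–Kakutani theorem turns these functionals into a measure on a disjoint union of copies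
of that compactification, and `φ ↦ φ e_a` extends to an isometry of `L^p` of this measure into the
ultraproduct. Maximality of the family makes it surjective (`AsympDisjoint.lpToUltra_surjective`).
-/

/-! ### A superinvariant vector for a strictly contractive nonnegative matrix -/

section Superinvariant

open Filter Topology

/-- A nonnegative matrix `t` that strictly contracts the `ℓ^q`-norm has a strictly positive vector
`u` with `tᵀ (t u)^(q-1) ≤ u^(q-1)`. For `q > 1` it is a maximum point of
`‖t f‖^q - ‖f‖^q + a ∑ f` on the positive cone: the one-sided derivatives there are nonpositive,
and the linear term forces all coordinates to be positive. -/
theorem exists_pos_superinvariant {I : Type*} [Fintype I] {q : ℝ} (hq : 1 ≤ q)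
    (t : I → I → ℝ) (ht : ∀ i j, 0 ≤ t i j) {r : ℝ} (hr : r < 1)
    (hT : ∀ f : I → ℝ, (∀ j, 0 ≤ f j) → ∑ i, (∑ j, t i j * f j) ^ q ≤ r * ∑ j, f j ^ q) :
    ∃ u : I → ℝ, (∀ j, 0 < u j) ∧
      ∀ j, ∑ i, t i j * (∑ k, t i k * u k) ^ (q - 1) ≤ u j ^ (q - 1) := by
  classical
  rcases hq.eq_or_lt with rfl | hq1
  · refine ⟨fun _ => 1, fun _ => one_pos, fun j => ?_⟩
    have h := hT (Pi.single j 1) (fun k => by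
      by_cases h : k = j
      · subst h; simp
      · simp [h])
    simp only [Real.rpow_one, Pi.single_apply, mul_ite, mul_one, mul_zero, Finset.sum_ite_eq',
      Finset.mem_univ, if_true] at h
    simp only [sub_self, Real.rpow_zero, mul_one]
    linarith
  · set a : ℝ := 1 - r with ha
    have ha0 : 0 < a := by linarith
    let Φ : (I → ℝ) → ℝ := fun f =>
      ∑ i, (∑ j, t i j * f j) ^ q - ∑ j, f j ^ q + a * ∑ j, f j
    have hΦle : ∀ f : I → ℝ, (∀ j, 0 ≤ f j) → Φ f ≤ a * ∑ j, (f j - f j ^ q) := by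
      intro f hf
      have := hT f hf
      simp only [Φ, Finset.sum_sub_distrib, ha]
      nlinarith
    have hx1 : ∀ x : ℝ, 0 ≤ x → x - x ^ q ≤ 1 := by
      intro x hx
      rcases le_total x 1 with h | h
      · have := Real.rpow_nonneg hx q
        linarith
      · have := Real.self_le_rpow_of_one_le h hq
        linarith
    -- The constant `C` satisfies `C ^ q - C > card I`, so `Φ` is negative on the far faces of the
    -- cube `[0, C] ^ I`.
    set n : ℝ := (Fintype.card I : ℝ) with hn
    have hn0 : 0 ≤ n := by positivity
    set C : ℝ := (n + 2) ^ (1 / (q - 1)) with hC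
    have hC1 : 1 ≤ C := Real.one_le_rpow (by linarith) (by
      have : 0 < q - 1 := by linarith
      positivity)
    have hCq : C - C ^ q < -n := by
      have h1 : C ^ (q - 1) = n + 2 := by
        rw [hC, ← Real.rpow_mul (by linarith), one_div_mul_cancel (by linarith), Real.rpow_one]
      have h2 : C ^ q = C * C ^ (q - 1) := by
        rw [← Real.rpow_one_add' (by linarith) (by linarith)]
        ring_nf
      rw [h2, h1]
      nlinarith
    have hcont : Continuous Φ := by
      have : 0 ≤ q := by linarith
      have hpow : Continuous fun x : ℝ => x ^ q := Real.continuous_rpow_const this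
      fun_prop
    let K : Set (I → ℝ) := Set.Icc 0 (fun _ => C)
    have hK0 : (0 : I → ℝ) ∈ K := ⟨le_rfl, fun _ => by simp; linarith⟩
    obtain ⟨u, huK, hmax⟩ := (isCompact_Icc : IsCompact K).exists_isMaxOn ⟨0, hK0⟩
      hcont.continuousOn
    have hu0 : ∀ j, 0 ≤ u j := fun j => huK.1 j
    have hΦ0 : Φ 0 = 0 := by
      simp [Φ, Real.zero_rpow (by linarith : q ≠ 0)]
    have huC : ∀ j, u j < C := by
      intro j
      refine lt_of_le_of_ne (huK.2 j) fun hj => ?_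
      have h1 : 0 ≤ Φ u := hΦ0 ▸ hmax hK0
      have h2 := hΦle u hu0
      have h3 : ∑ k, (u k - u k ^ q) ≤ (C - C ^ q) + n := by
        rw [← Finset.add_sum_erase _ _ (Finset.mem_univ j), hj]
        gcongr
        refine (Finset.sum_le_card_nsmul _ _ 1 fun k _ => hx1 _ (hu0 k)).trans ?_
        rw [nsmul_eq_mul, mul_one, hn]
        exact_mod_cast Finset.card_le_univ _
      nlinarith
    have hder : ∀ j, ∑ i, q * (∑ k, t i k * u k) ^ (q - 1) * t i j - q * u j ^ (q - 1) + a ≤ 0 := by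
      intro j
      let g : ℝ → ℝ := fun s => ∑ i, ((∑ k, t i k * u k) + s * t i j) ^ q
        - ∑ k, (u k + s * (Pi.single j 1 : I → ℝ) k) ^ q
        + a * ∑ k, (u k + s * (Pi.single j 1 : I → ℝ) k)
      have hg : ∀ s, g s = Φ (u + s • Pi.single j 1) := by
        intro s
        have : ∀ i, ∑ k, t i k * (u k + s * (Pi.single j 1 : I → ℝ) k)
            = (∑ k, t i k * u k) + s * t i j := by
          intro i
          simp only [mul_add, Finset.sum_add_distrib, Pi.single_apply, mul_ite, mul_one, mul_zero,
            Finset.sum_ite_eq', Finset.mem_univ, if_true]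
          ring
        simp only [g, Φ, Pi.add_apply, Pi.smul_apply, smul_eq_mul, this]
      have hlin : ∀ x y : ℝ, HasDerivAt (fun s : ℝ => x + s * y) y 0 := fun x y => by
        simpa using ((hasDerivAt_id (0 : ℝ)).mul_const y).const_add x
      have hpow : ∀ x y : ℝ, HasDerivAt (fun s : ℝ => (x + s * y) ^ q) (q * x ^ (q - 1) * y) 0 := by
        intro x y
        have := (hlin x y).rpow_const (p := q) (Or.inr hq)
        simp only [zero_mul, add_zero] at this
        exact this.congr_deriv (by ring)
      have hd : HasDerivAt g (∑ i, q * (∑ k, t i k * u k) ^ (q - 1) * t i j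
          - ∑ k, q * u k ^ (q - 1) * (Pi.single j 1 : I → ℝ) k
          + a * ∑ k, (Pi.single j 1 : I → ℝ) k) 0 :=
        ((HasDerivAt.fun_sum fun i _ => hpow _ _).sub
          (HasDerivAt.fun_sum fun k _ => hpow _ _)).add
          ((HasDerivAt.fun_sum fun k _ => hlin _ _).const_mul a)
      simp only [Pi.single_apply, mul_ite, mul_one, mul_zero, Finset.sum_ite_eq',
            Finset.mem_univ, if_true] at hd
      refine le_of_tendsto hd.tendsto_slope_zero_right ?_
      have hpos : (0 : ℝ) < C - u j := by linarith [huC j]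
      filter_upwards [Ioo_mem_nhdsGT hpos] with s hs
      have hle : g s ≤ g 0 := by
        rw [hg, hg, zero_smul, add_zero]
        refine hmax ⟨fun k => ?_, fun k => ?_⟩
        · by_cases h : k = j
          · subst h; simpa using add_nonneg (hu0 k) hs.1.le
          · simpa [h] using hu0 k
        · by_cases h : k = j
          · subst h; simp; linarith [hs.2]
          · simpa [h] using (huC k).le
      rw [zero_add, smul_eq_mul]
      exact mul_nonpos_of_nonneg_of_nonpos (inv_nonneg.2 hs.1.le) (by linarith)
    have hkey : ∀ j, q * ∑ i, t i j * (∑ k, t i k * u k) ^ (q - 1) + a ≤ q * u j ^ (q - 1) := by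
      intro j
      have := hder j
      have h2 : ∑ i, q * (∑ k, t i k * u k) ^ (q - 1) * t i j
          = q * ∑ i, t i j * (∑ k, t i k * u k) ^ (q - 1) := by
        rw [Finset.mul_sum]
        exact Finset.sum_congr rfl fun i _ => by ring
      linarith
    refine ⟨u, fun j => ?_, fun j => ?_⟩
    · refine lt_of_le_of_ne (hu0 j) fun h => ?_
      have h1 := hkey j
      rw [← h, Real.zero_rpow (by linarith), mul_zero] at h1
      have h2 : 0 ≤ ∑ i, t i j * (∑ k, t i k * u k) ^ (q - 1) :=
        Finset.sum_nonneg fun i _ => mul_nonneg (ht i j) (Real.rpow_nonneg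
          (Finset.sum_nonneg fun k _ => mul_nonneg (ht i k) (hu0 k)) _)
      nlinarith
    · have := hkey j
      nlinarith

end Superinvariant

/-! ### Finite path spaces -/

section PathSpace

/-- The function `x ↦ x ^ (q - 1)` on the nonnegative reals, with value `0` at `0` also for
`q = 1`. It maps the density of an embedding of `ℓ^q` to the density of the adjoint projection. -/
noncomputable def dualPow (q x : ℝ) : ℝ := if x = 0 then 0 else x ^ (q - 1)

theorem dualPow_nonneg {q x : ℝ} (hx : 0 ≤ x) : 0 ≤ dualPow q x := by
  unfold dualPow
  split_ifs
  · exact le_rfl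
  · exact Real.rpow_nonneg hx _

theorem dualPow_zero (q : ℝ) : dualPow q 0 = 0 := if_pos rfl

theorem dualPow_mul {q x y : ℝ} (hx : 0 ≤ x) (hy : 0 ≤ y) :
    dualPow q (x * y) = dualPow q x * dualPow q y := by
  unfold dualPow
  by_cases h1 : x = 0
  · simp [h1]
  by_cases h2 : y = 0
  · simp [h2]
  simp [h1, h2, Real.mul_rpow hx hy]

theorem dualPow_mul_self {q : ℝ} (hq : 1 ≤ q) (x : ℝ) : dualPow q x * x = x ^ q := by
  unfold dualPow
  by_cases h1 : x = 0
  · simp [h1, Real.zero_rpow (by linarith : q ≠ 0)]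
  · rw [if_neg h1, Real.rpow_sub_one h1, div_mul_cancel₀ _ h1]

/-- Path spaces of finite length for a nonnegative matrix `t` with a superinvariant vector `u`.
A point `z` is a path whose state at time `s` is `j s z`, and `c s z` is a density which makes
`f ↦ c s · f (j s ·)` isometric on `ℓ^q`. Paths follow the Markov chain with transition
probabilities `t i k * u k / (t u) i`, the density being multiplied by `(t u) i / u k` at a step
from `i` to `k`, and new paths are born at each time with whatever mass is missing. The last
property says that the compression from time `s'` to time `s ≤ s'` is the power `s' - s` of the
matrix. -/
theorem exists_pathSpace {I : Type u} [Fintype I] {q : ℝ} (hq : 1 ≤ q)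
    (t : I → I → ℝ) (ht : ∀ i j, 0 ≤ t i j) (u : I → ℝ) (hu : ∀ j, 0 < u j)
    (hsup : ∀ j, ∑ i, t i j * (∑ k, t i k * u k) ^ (q - 1) ≤ u j ^ (q - 1))
    (E : Type*) [AddCommGroup E] [Module ℝ E] (N : ℕ) :
    ∃ (Z : Type u) (_ : Fintype Z) (c : ℕ → Z → ℝ) (j : ℕ → Z → I),
      (∀ s z, 0 ≤ c s z) ∧
      (∀ s ≤ N, ∀ g : I → ℝ, ∑ z, c s z ^ q * g (j s z) = ∑ k, g k) ∧
      (∀ s s', s ≤ s' → s' ≤ N → ∀ (g : I → ℝ) (f : I → E),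
        ∑ z, (dualPow q (c s z) * c s' z * g (j s z)) • f (j s' z) =
          ∑ k, g k • ((fun (h : I → E) i => ∑ l, t i l • h l)^[s' - s] f) k) := by
  classical
  have hq0 : q ≠ 0 := by linarith
  have hq0' : 0 < q := by linarith
  set v : I → ℝ := fun i => ∑ k, t i k * u k with hv
  have hv0 : ∀ i, 0 ≤ v i := fun i => Finset.sum_nonneg fun k _ => mul_nonneg (ht i k) (hu k).le
  have htv : ∀ i, v i = 0 → ∀ k, t i k = 0 := by
    intro i hi k
    have := (Finset.sum_eq_zero_iff_of_nonneg fun k _ => mul_nonneg (ht i k) (hu k).le).1 hi k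
      (Finset.mem_univ k)
    exact (mul_eq_zero.1 this).resolve_right (hu k).ne'
  -- The transition probabilities of the Markov chain of paths.
  let w : I → I → ℝ := fun i k => if v i = 0 then (if k = i then 1 else 0) else t i k * u k / v i
  have hw0 : ∀ i k, 0 ≤ w i k := by
    intro i k
    simp only [w]
    split_ifs
    · exact zero_le_one
    · exact le_rfl
    · exact div_nonneg (mul_nonneg (ht i k) (hu k).le) (hv0 i)
  have hw1 : ∀ i, ∑ k, w i k = 1 := by
    intro i
    by_cases h : v i = 0
    · simp [w, h]
    · simp only [w, h, if_false]
      rw [← Finset.sum_div]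
      exact div_self h
  have hwv : ∀ i k, w i k * (v i / u k) = t i k := by
    intro i k
    by_cases h : v i = 0
    · simp [h, htv i h k]
    · simp only [w, h, if_false]
      have := (hu k).ne'
      field_simp
  -- The mass that one step of the chain carries to `k`; superinvariance of `u` bounds it by one.
  let ρ : I → ℝ := fun k => ∑ i, w i k * (v i / u k) ^ q
  have hρ : ∀ k, ρ k ≤ 1 := by
    intro k
    have h1 : ∀ i, w i k * (v i / u k) ^ q = t i k * v i ^ (q - 1) / u k ^ (q - 1) := by
      intro i
      rw [← hwv i k, ← dualPow_mul_self hq (v i / u k)]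
      by_cases h : v i = 0
      · simp [h]
      · rw [dualPow, if_neg (div_ne_zero h (hu k).ne'), Real.div_rpow (hv0 i) (hu k).le]
        ring
    simp only [ρ, h1]
    rw [← Finset.sum_div, div_le_one (Real.rpow_pos_of_pos (hu k) _)]
    exact hsup k
  let y : I → I → ℝ := fun i k => w i k ^ (1 / q)
  have hy0 : ∀ i k, 0 ≤ y i k := fun i k => Real.rpow_nonneg (hw0 i k) _
  have hyq : ∀ i k, y i k ^ q = w i k := fun i k => by
    simp only [y]
    rw [← Real.rpow_mul (hw0 i k), one_div_mul_cancel hq0, Real.rpow_one]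
  have hyd : ∀ i k, dualPow q (y i k) * y i k = w i k := fun i k => by
    rw [dualPow_mul_self hq, hyq]
  induction N with
  | zero =>
    refine ⟨I, inferInstance, fun _ _ => 1, fun _ z => z, fun _ _ => zero_le_one, ?_, ?_⟩
    · intro s _ g
      simp
    · intro s s' h1 h2 g f
      obtain rfl : s' = 0 := by omega
      obtain rfl : s = 0 := by omega
      simp [dualPow]
  | succ N ih =>
    obtain ⟨Z, hZ, c, j, hc, hiso, hcomp⟩ := ih
    -- A path is prolonged by a state, which leaves its densities at earlier times unchanged up to
    -- the probability of the step, or it is born at time `N + 1` with the missing mass.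
    let c' : ℕ → (Z × I) ⊕ I → ℝ := fun s => Sum.elim
      (fun x => if s ≤ N then c s x.1 * y (j N x.1) x.2
        else c N x.1 * y (j N x.1) x.2 * (v (j N x.1) / u x.2))
      (fun i => if s ≤ N then 0 else (1 - ρ i) ^ (1 / q))
    let j' : ℕ → (Z × I) ⊕ I → I := fun s => Sum.elim
      (fun x => if s ≤ N then j s x.1 else x.2) id
    have hc' : ∀ s z, 0 ≤ c' s z := by
      rintro s (x | i)
      · simp only [c', Sum.elim_inl]
        have h1 := hy0 (j N x.1) x.2
        have h2 := div_nonneg (hv0 (j N x.1)) (hu x.2).le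
        split_ifs
        · exact mul_nonneg (hc _ _) h1
        · exact mul_nonneg (mul_nonneg (hc _ _) h1) h2
      · simp only [c', Sum.elim_inr]
        split_ifs
        · exact le_rfl
        · exact Real.rpow_nonneg (by linarith [hρ i]) _
    have hnot : ¬ (N + 1 ≤ N) := by omega
    have hiso' : ∀ s ≤ N + 1, ∀ g : I → ℝ, ∑ z, c' s z ^ q * g (j' s z) = ∑ k, g k := by
      intro s hs g
      rw [Fintype.sum_sum_type, Fintype.sum_prod_type]
      rcases Nat.lt_or_ge N s with h | h
      · obtain rfl : s = N + 1 := by omega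
        simp only [c', j', Sum.elim_inl, Sum.elim_inr, hnot, if_false, id]
        have h1 : ∀ z : Z, ∑ k, (c N z * y (j N z) k * (v (j N z) / u k)) ^ q * g k
            = c N z ^ q * (fun i => ∑ k, w i k * (v i / u k) ^ q * g k) (j N z) := by
          intro z
          rw [Finset.mul_sum]
          refine Finset.sum_congr rfl fun k _ => ?_
          rw [Real.mul_rpow (mul_nonneg (hc _ _) (hy0 _ _)) (div_nonneg (hv0 _) (hu k).le),
            Real.mul_rpow (hc _ _) (hy0 _ _), hyq]
          ring
        have h2 : ∀ k, ((1 - ρ k) ^ (1 / q)) ^ q = 1 - ρ k := fun k => by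
          rw [← Real.rpow_mul (by linarith [hρ k]), one_div_mul_cancel hq0, Real.rpow_one]
        simp only [h1, h2]
        rw [hiso N le_rfl (fun i => ∑ k, w i k * (v i / u k) ^ q * g k), Finset.sum_comm,
          ← Finset.sum_add_distrib]
        refine Finset.sum_congr rfl fun k _ => ?_
        rw [← Finset.sum_mul]
        simp only [ρ]
        ring
      · simp only [c', j', Sum.elim_inl, Sum.elim_inr, h, if_true, Real.zero_rpow hq0, zero_mul,
          Finset.sum_const_zero, add_zero]
        rw [← hiso s h g]
        refine Finset.sum_congr rfl fun z _ => ?_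
        have h1 : ∀ k, (c s z * y (j N z) k) ^ q * g (j s z)
            = w (j N z) k * (c s z ^ q * g (j s z)) := by
          intro k
          rw [Real.mul_rpow (hc _ _) (hy0 _ _), hyq]
          ring
        simp only [h1]
        rw [← Finset.sum_mul, hw1, one_mul]
    refine ⟨(Z × I) ⊕ I, inferInstance, c', j', hc', hiso', ?_⟩
    intro s s' hss' hs' g f
    rcases Nat.lt_or_ge N s with h | h
    · obtain rfl : s = N + 1 := by omega
      obtain rfl : s' = N + 1 := by omega
      simp only [dualPow_mul_self hq, Nat.sub_self, Function.iterate_zero, id]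
      have h1 := fun k : I => hiso' (N + 1) le_rfl (fun i => if i = k then g i else 0)
      have h2 : ∀ z, (c' (N + 1) z ^ q * g (j' (N + 1) z)) • f (j' (N + 1) z)
          = ∑ k, (c' (N + 1) z ^ q * (if j' (N + 1) z = k then g (j' (N + 1) z) else 0)) • f k := by
        intro z
        simp
      simp only [h2]
      rw [Finset.sum_comm]
      refine Finset.sum_congr rfl fun k _ => ?_
      rw [← Finset.sum_smul, h1 k]
      simp
    · rw [Fintype.sum_sum_type, Fintype.sum_prod_type]
      simp only [c', j', Sum.elim_inl, Sum.elim_inr, h, if_true, dualPow_zero, zero_mul, zero_smul,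
        Finset.sum_const_zero, add_zero]
      rcases Nat.lt_or_ge N s' with h' | h'
      · obtain rfl : s' = N + 1 := by omega
        simp only [hnot, if_false]
        have h1 : ∀ z : Z, ∑ k, (dualPow q (c s z * y (j N z) k)
              * (c N z * y (j N z) k * (v (j N z) / u k)) * g (j s z)) • f k
            = (dualPow q (c s z) * c N z * g (j s z)) • ∑ l, t (j N z) l • f l := by
          intro z
          rw [Finset.smul_sum]
          refine Finset.sum_congr rfl fun k _ => ?_
          rw [smul_smul, ← hwv, ← hyd, dualPow_mul (hc _ _) (hy0 _ _)]
          congr 1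
          ring
        simp only [h1]
        rw [hcomp s N h le_rfl g (fun i => ∑ l, t i l • f l)]
        rw [show N + 1 - s = (N - s) + 1 by omega, Function.iterate_succ_apply]
      · simp only [h', if_true]
        rw [← hcomp s s' hss' h' g f]
        refine Finset.sum_congr rfl fun z _ => ?_
        have h1 : ∀ k, (dualPow q (c s z * y (j N z) k) * (c s' z * y (j N z) k) * g (j s z))
              • f (j s' z)
            = w (j N z) k • ((dualPow q (c s z) * c s' z * g (j s z)) • f (j s' z)) := by
          intro k
          rw [smul_smul, ← hyd, dualPow_mul (hc _ _) (hy0 _ _)]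
          congr 1
          ring
        simp only [h1]
        rw [← Finset.sum_smul, hw1, one_smul]

end PathSpace

/-! ### Finite-dimensional approximate dilations -/

section FiniteDilation

variable {𝕜 : Type*} [RCLike 𝕜]

/-- A scalar-valued function is nonnegative if its values are real and nonnegative. -/
def FunNonneg {Z : Type*} (x : Z → 𝕜) : Prop :=
  ∀ z, 0 ≤ RCLike.re (x z) ∧ RCLike.im (x z) = 0

theorem FunNonneg.eq_ofReal_re {Z : Type*} {x : Z → 𝕜} (hx : FunNonneg x) (z : Z) :
    x z = ((RCLike.re (x z) : ℝ) : 𝕜) := by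
  conv_lhs => rw [← RCLike.re_add_im (x z), (hx z).2]
  simp

theorem PiLp.norm_rpow_toReal {Z : Type*} [Fintype Z] {p : ℝ≥0∞} [Fact (1 ≤ p)] (hp : p ≠ ∞)
    (x : PiLp p (fun _ : Z => 𝕜)) : ‖x‖ ^ p.toReal = ∑ z, ‖x z‖ ^ p.toReal := by
  have h0 : 0 < p.toReal :=
    ENNReal.toReal_pos (zero_lt_one.trans_le (Fact.out : 1 ≤ p)).ne' hp
  rw [PiLp.norm_eq_sum h0, ← Real.rpow_mul (Finset.sum_nonneg fun z _ =>
    Real.rpow_nonneg (norm_nonneg _) _), one_div_mul_cancel h0.ne', Real.rpow_one]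

theorem one_le_toReal_of_fact {p : ℝ≥0∞} [Fact (1 ≤ p)] (hp : p ≠ ∞) : 1 ≤ p.toReal := by
  have := ENNReal.toReal_mono hp (Fact.out : 1 ≤ p)
  simpa using this

theorem PiLp.norm_le_of_sum_rpow_le {Z Z' : Type*} [Fintype Z] [Fintype Z'] {p : ℝ≥0∞}
    [Fact (1 ≤ p)] (hp : p ≠ ∞) {x : PiLp p (fun _ : Z => 𝕜)} {y : PiLp p (fun _ : Z' => 𝕜)}
    (h : ∑ z, ‖x z‖ ^ p.toReal ≤ ∑ z, ‖y z‖ ^ p.toReal) : ‖x‖ ≤ ‖y‖ := by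
  rw [← PiLp.norm_rpow_toReal hp, ← PiLp.norm_rpow_toReal hp] at h
  have := one_le_toReal_of_fact hp
  exact (Real.rpow_le_rpow_iff (norm_nonneg _) (norm_nonneg _) (by linarith)).1 h

/-- The weighted composition operator `f ↦ c · f ∘ j`, an isometry of `ℓ^p` spaces if the weight
has `p`-th moment one over every point. -/
noncomputable def weightedEmb {I Z : Type*} [Fintype I] [Fintype Z] (p : ℝ≥0∞) [Fact (1 ≤ p)]
    (hp : p ≠ ∞) (c : Z → ℝ) (j : Z → I) (hc : ∀ z, 0 ≤ c z)
    (hcj : ∀ g : I → ℝ, ∑ z, c z ^ p.toReal * g (j z) = ∑ k, g k) :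
    PiLp p (fun _ : I => 𝕜) →ₗᵢ[𝕜] PiLp p (fun _ : Z => 𝕜) where
  toFun f := WithLp.toLp p fun z => (c z : 𝕜) * f (j z)
  map_add' f g := by ext z; simp [mul_add]
  map_smul' a f := by ext z; simp [mul_left_comm]
  norm_map' f := by
    have h : ∑ z, ‖(WithLp.toLp p fun z => (c z : 𝕜) * f (j z) : PiLp p fun _ : Z => 𝕜) z‖
        ^ p.toReal = ∑ k, ‖f k‖ ^ p.toReal := by
      rw [← hcj]
      refine Finset.sum_congr rfl fun z _ => ?_
      simp only [norm_mul, RCLike.norm_ofReal, abs_of_nonneg (hc z)]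
      exact Real.mul_rpow (hc z) (norm_nonneg _)
    exact le_antisymm (PiLp.norm_le_of_sum_rpow_le hp h.le) (PiLp.norm_le_of_sum_rpow_le hp h.ge)

open Classical in
/-- The adjoint projection of a weighted composition operator: the weighted conditional
expectation that is its positive contractive left inverse. -/
noncomputable def weightedExp {I Z : Type*} [Fintype I] [Fintype Z] (p : ℝ≥0∞) [Fact (1 ≤ p)]
    (hp : p ≠ ∞) (c : Z → ℝ) (j : Z → I) (hc : ∀ z, 0 ≤ c z)
    (hcj : ∀ g : I → ℝ, ∑ z, c z ^ p.toReal * g (j z) = ∑ k, g k) :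
    PiLp p (fun _ : Z => 𝕜) →L[𝕜] PiLp p (fun _ : I => 𝕜) :=
  LinearMap.mkContinuous
    { toFun := fun x => WithLp.toLp p fun k =>
        ∑ z, (if j z = k then (dualPow p.toReal (c z) : 𝕜) else 0) * x z
      map_add' := by intro x y; ext k; simp [mul_add, Finset.sum_add_distrib]
      map_smul' := by intro a x; ext k; simp [Finset.mul_sum, mul_left_comm] } 1
    (by
      intro x
      rw [one_mul]
      have hq := one_le_toReal_of_fact hp
      apply PiLp.norm_le_of_sum_rpow_le hp
      -- On each fibre this is Jensen's inequality for the weights `c ^ p`.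
      have key : ∀ k, ‖∑ z, (if j z = k then (dualPow p.toReal (c z) : 𝕜) else 0) * x z‖
          ^ p.toReal ≤ ∑ z, if j z = k then ‖x z‖ ^ p.toReal else 0 := by
        intro k
        set q := p.toReal with hqdef
        let w : Z → ℝ := fun z => if j z = k then c z ^ q else 0
        have hw0 : ∀ z, 0 ≤ w z := fun z => by
          simp only [w]; split_ifs
          · exact Real.rpow_nonneg (hc z) _
          · exact le_rfl
        have hw1 : ∑ z, w z = 1 := by
          have := hcj (fun i => if i = k then 1 else 0)
          simpa [w] using this
        have h1 : ‖∑ z, (if j z = k then (dualPow q (c z) : 𝕜) else 0) * x z‖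
            ≤ ∑ z, w z * (‖x z‖ / c z) := by
          refine (norm_sum_le _ _).trans (le_of_eq (Finset.sum_congr rfl fun z _ => ?_))
          simp only [w]
          split_ifs with h
          · rw [norm_mul, RCLike.norm_ofReal, abs_of_nonneg (dualPow_nonneg (hc z)),
              ← dualPow_mul_self hq]
            by_cases h0 : c z = 0
            · simp [h0, dualPow_zero]
            · field_simp
          · simp
        refine (Real.rpow_le_rpow (norm_nonneg _) h1 (by linarith)).trans ?_
        refine (Real.rpow_arith_mean_le_arith_mean_rpow Finset.univ w _ (fun z _ => hw0 z) hw1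
          (fun z _ => div_nonneg (norm_nonneg _) (hc z)) hq).trans ?_
        refine Finset.sum_le_sum fun z _ => ?_
        simp only [w]
        split_ifs with h
        · by_cases h0 : c z = 0
          · rw [h0, Real.zero_rpow (by linarith), zero_mul]
            exact Real.rpow_nonneg (norm_nonneg _) _
          · rw [Real.div_rpow (norm_nonneg _) (hc z), mul_div_cancel₀]
            exact (Real.rpow_pos_of_pos (lt_of_le_of_ne (hc z) (Ne.symm h0)) _).ne'
        · rw [zero_mul]
      refine (Finset.sum_le_sum fun k _ => key k).trans ?_
      rw [Finset.sum_comm]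
      simp)

section WeightedOperators

variable {I Z : Type*} [Fintype I] [Fintype Z] {p : ℝ≥0∞} [Fact (1 ≤ p)]
    (hp : p ≠ ∞) (c : Z → ℝ) (j : Z → I) (hc : ∀ z, 0 ≤ c z)
    (hcj : ∀ g : I → ℝ, ∑ z, c z ^ p.toReal * g (j z) = ∑ k, g k)

theorem weightedEmb_apply (f : PiLp p (fun _ : I => 𝕜)) (z : Z) :
    weightedEmb p hp c j hc hcj f z = (c z : 𝕜) * f (j z) := rfl

open Classical in
theorem weightedExp_apply (x : PiLp p (fun _ : Z => 𝕜)) (k : I) :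
    weightedExp p hp c j hc hcj x k
      = ∑ z, (if j z = k then (dualPow p.toReal (c z) : 𝕜) else 0) * x z := rfl

theorem norm_weightedExp_le : ‖weightedExp (𝕜 := 𝕜) p hp c j hc hcj‖ ≤ 1 :=
  LinearMap.mkContinuous_norm_le _ zero_le_one _

theorem weightedExp_weightedEmb (f : PiLp p (fun _ : I => 𝕜)) :
    weightedExp p hp c j hc hcj (weightedEmb p hp c j hc hcj f) = f := by
  classical
  ext k
  rw [weightedExp_apply]
  have h := hcj (fun i => if i = k then 1 else 0)
  have h1 : ∀ z, (if j z = k then (dualPow p.toReal (c z) : 𝕜) else 0)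
      * weightedEmb p hp c j hc hcj f z
      = ((c z ^ p.toReal * (if j z = k then 1 else 0) : ℝ) : 𝕜) * f k := by
    intro z
    rw [weightedEmb_apply]
    split_ifs with hz
    · rw [hz, ← dualPow_mul_self (one_le_toReal_of_fact hp)]
      push_cast
      ring
    · simp
  rw [Finset.sum_congr rfl fun z _ => h1 z, ← Finset.sum_mul, ← RCLike.ofReal_sum, h]
  simp

theorem weightedEmb_nonneg {f : PiLp p (fun _ : I => 𝕜)} (hf : FunNonneg f) :
    FunNonneg (weightedEmb p hp c j hc hcj f) := by
  intro z
  rw [weightedEmb_apply, RCLike.re_ofReal_mul, RCLike.im_ofReal_mul, (hf _).2, mul_zero]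
  exact ⟨mul_nonneg (hc z) (hf _).1, rfl⟩

theorem weightedExp_nonneg {x : PiLp p (fun _ : Z => 𝕜)} (hx : FunNonneg x) :
    FunNonneg (weightedExp p hp c j hc hcj x) := by
  classical
  intro k
  rw [weightedExp_apply, map_sum, map_sum]
  refine ⟨Finset.sum_nonneg fun z _ => ?_, Finset.sum_eq_zero fun z _ => ?_⟩
  · split_ifs
    · rw [RCLike.re_ofReal_mul]
      exact mul_nonneg (dualPow_nonneg (hc z)) (hx z).1
    · simp
  · split_ifs
    · rw [RCLike.im_ofReal_mul, (hx z).2, mul_zero]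
    · simp

end WeightedOperators

/-- A positive strict contraction `A` of a finite-dimensional `ℓ^p` has, for each `N`, a dilation
to a finite-dimensional `ℓ^p` whose isometry is a permutation of the coordinates, up to an error
of order `k / (N + 1)` for the `k`-th power. The coordinates are the pairs of a path and a time
in `Fin (N + 1)`, and the permutation is the cyclic shift of time; the error comes from the times
at which the shift wraps around. -/
theorem exists_finite_dilation {I : Type u} [Fintype I] {p : ℝ≥0∞} [Fact (1 ≤ p)] (hp : p ≠ ∞)
    (A : PiLp p (fun _ : I => 𝕜) →L[𝕜] PiLp p (fun _ : I => 𝕜)) (hA : ‖A‖ < 1)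
    (hApos : ∀ f : PiLp p (fun _ : I => 𝕜), FunNonneg f → FunNonneg (A f)) (N : ℕ) :
    ∃ (Z : Type u) (_ : Fintype Z) (σ : Equiv.Perm Z)
      (D : PiLp p (fun _ : I => 𝕜) →ₗᵢ[𝕜] PiLp p (fun _ : Z => 𝕜))
      (Q : PiLp p (fun _ : Z => 𝕜) →L[𝕜] PiLp p (fun _ : I => 𝕜)),
      (∀ f : PiLp p (fun _ : I => 𝕜), FunNonneg f → FunNonneg (D f)) ∧
      (∀ x : PiLp p (fun _ : Z => 𝕜), FunNonneg x → FunNonneg (Q x)) ∧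
      ‖Q‖ ≤ 1 ∧ (∀ f, Q (D f) = f) ∧
      ∀ (k : ℕ) f, ‖Q (((LinearIsometryEquiv.piLpCongrLeft p 𝕜 𝕜 σ) ^ k) (D f)) - (A ^ k) f‖
        ≤ 2 * k / (N + 1) * ‖f‖ := by
  classical
  have hq := one_le_toReal_of_fact hp
  set q := p.toReal with hqdef
  have hq0 : q ≠ 0 := by linarith
  -- The matrix of `A`.
  let t : I → I → ℝ := fun i l => RCLike.re (A (PiLp.single p l (1 : 𝕜)) i)
  have hsingle : ∀ l : I, FunNonneg (PiLp.single p l (1 : 𝕜) : PiLp p fun _ : I => 𝕜) := by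
    intro l i
    by_cases h : i = l
    · subst h; simp
    · simp [h]
  have ht : ∀ i l, 0 ≤ t i l := fun i l => (hApos _ (hsingle l) i).1
  have htA : ∀ i l, A (PiLp.single p l (1 : 𝕜)) i = (t i l : 𝕜) := fun i l =>
    (hApos _ (hsingle l)).eq_ofReal_re i
  have hAt : ∀ (f : PiLp p (fun _ : I => 𝕜)) (i : I), A f i = ∑ l, t i l • f l := by
    intro f i
    have hf : f = ∑ l, f l • (PiLp.single p l (1 : 𝕜) : PiLp p fun _ : I => 𝕜) := by
      ext i
      simp [Pi.single_apply]
    conv_lhs => rw [hf, map_sum]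
    rw [WithLp.ofLp_sum, Finset.sum_apply]
    refine Finset.sum_congr rfl fun l _ => ?_
    rw [map_smul, PiLp.smul_apply, htA, smul_eq_mul, RCLike.real_smul_eq_coe_mul, mul_comm]
  have hT : ∀ f : I → ℝ, (∀ l, 0 ≤ f l) →
      ∑ i, (∑ l, t i l * f l) ^ q ≤ ‖A‖ ^ q * ∑ l, f l ^ q := by
    intro f hf
    let x : PiLp p (fun _ : I => 𝕜) := WithLp.toLp p fun l => (f l : 𝕜)
    have h1 : ‖A x‖ ^ q ≤ (‖A‖ * ‖x‖) ^ q :=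
      Real.rpow_le_rpow (norm_nonneg _) (A.le_opNorm x) (by linarith)
    rw [Real.mul_rpow (norm_nonneg _) (norm_nonneg _), PiLp.norm_rpow_toReal hp,
      PiLp.norm_rpow_toReal hp] at h1
    convert h1 using 3 with i _ i _
    · have : A x i = ((∑ l, t i l * f l : ℝ) : 𝕜) := by
        rw [hAt]
        simp [x, RCLike.real_smul_eq_coe_mul]
      rw [this, RCLike.norm_ofReal, abs_of_nonneg]
      exact Finset.sum_nonneg fun l _ => mul_nonneg (ht i l) (hf l)
    · simp [x, abs_of_nonneg (hf i), hqdef]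
  obtain ⟨u, hu, hsup⟩ := exists_pos_superinvariant hq t ht
    (Real.rpow_lt_one (norm_nonneg A) hA (by linarith)) hT
  obtain ⟨Z, hZ, c, j, hc, hiso, hcomp⟩ := exists_pathSpace hq t ht u hu hsup 𝕜 N
  have hApow : ∀ (n : ℕ) (f : PiLp p (fun _ : I => 𝕜)) (i : I),
      (A ^ n) f i = ((fun (h : I → 𝕜) i => ∑ l, t i l • h l)^[n] (fun i => f i)) i := by
    intro n
    induction n with
    | zero => intro f i; rfl
    | succ n ih =>
      intro f i
      rw [pow_succ, mul_apply_eq_comp, ih, Function.iterate_succ_apply]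
      exact congrArg (fun h => (fun (h : I → 𝕜) i => ∑ l, t i l • h l)^[n] h i)
        (funext fun i => hAt f i)
  -- The marginal embeddings and projections at time `s`, and their compressions.
  have hisoF : ∀ (s : Fin (N + 1)) (g : I → ℝ), ∑ z, c s z ^ p.toReal * g (j s z) = ∑ k, g k :=
    fun s g => hiso s (Nat.lt_succ_iff.1 s.2) g
  let X : Fin (N + 1) → PiLp p (fun _ : I => 𝕜) →ₗᵢ[𝕜] PiLp p (fun _ : Z => 𝕜) := fun s =>
    weightedEmb p hp (c s) (j s) (hc s) (hisoF s)
  let Y : Fin (N + 1) → PiLp p (fun _ : Z => 𝕜) →L[𝕜] PiLp p (fun _ : I => 𝕜) := fun s =>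
    weightedExp p hp (c s) (j s) (hc s) (hisoF s)
  have hYX : ∀ (s s' : Fin (N + 1)) (n : ℕ), (s' : ℕ) = s + n → ∀ f, Y s (X s' f) = (A ^ n) f := by
    intro s s' n hn f
    ext i
    have h1 := hcomp s s' (by omega) (Nat.lt_succ_iff.1 s'.2) (fun k => if k = i then 1 else 0)
      (fun i => f i)
    have h2 : (s' : ℕ) - s = n := by omega
    rw [h2] at h1
    simp only [ite_smul, one_smul, zero_smul, Finset.sum_ite_eq', Finset.mem_univ, if_true] at h1
    rw [hApow, ← h1]
    change ∑ z, _ * ((c s' z : 𝕜) * f (j s' z)) = _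
    refine Finset.sum_congr rfl fun z _ => ?_
    split_ifs
    · rw [RCLike.real_smul_eq_coe_mul]
      push_cast
      ring
    · simp
  have hAn : ∀ n : ℕ, ∀ f, ‖(A ^ n) f‖ ≤ ‖f‖ := by
    intro n
    induction n with
    | zero => intro f; simp
    | succ n ih =>
      intro f
      rw [pow_succ, mul_apply_eq_comp]
      exact (ih _).trans (by simpa using A.le_of_opNorm_le hA.le f)
  -- The dilation space: paths with a uniformly distributed time.
  let m : ℝ := ((N : ℝ) + 1)⁻¹
  have hm0 : 0 < m := by positivity
  let a : ℝ := m ^ (1 / q)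
  have ha0 : 0 ≤ a := Real.rpow_nonneg hm0.le _
  have haq : a ^ q = m := by
    simp only [a]
    rw [← Real.rpow_mul hm0.le, one_div_mul_cancel hq0, Real.rpow_one]
  have had : dualPow q a * a = m := by rw [dualPow_mul_self hq, haq]
  let C : Z × Fin (N + 1) → ℝ := fun x => a * c x.2 x.1
  let J : Z × Fin (N + 1) → I := fun x => j x.2 x.1
  have hC : ∀ x, 0 ≤ C x := fun x => mul_nonneg ha0 (hc _ _)
  have hCJ : ∀ g : I → ℝ, ∑ x, C x ^ p.toReal * g (J x) = ∑ k, g k := by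
    intro g
    rw [Fintype.sum_prod_type_right]
    have h1 : ∀ s : Fin (N + 1), ∑ z, C (z, s) ^ p.toReal * g (J (z, s)) = m * ∑ k, g k := by
      intro s
      rw [← hisoF s g, Finset.mul_sum]
      refine Finset.sum_congr rfl fun z _ => ?_
      simp only [C, J]
      rw [Real.mul_rpow ha0 (hc _ _), ← hqdef, haq, mul_assoc]
    simp only [h1]
    rw [Finset.sum_const, Finset.card_univ, Fintype.card_fin, nsmul_eq_mul, ← mul_assoc]
    have : ((N + 1 : ℕ) : ℝ) * m = 1 := by
      simp only [m]; push_cast; field_simp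
    rw [this, one_mul]
  let τ : Equiv.Perm (Z × Fin (N + 1)) := Equiv.prodCongr (Equiv.refl Z) (Equiv.addRight 1)
  let S := LinearIsometryEquiv.piLpCongrLeft p 𝕜 𝕜 τ.symm
  have hS : ∀ (k : ℕ) (x : PiLp p (fun _ : Z × Fin (N + 1) => 𝕜)) (z : Z) (s : Fin (N + 1)),
      (S ^ k) x (z, s) = x (z, s + Fin.ofNat (N + 1) k) := by
    intro k
    induction k with
    | zero =>
      intro x z s
      have : Fin.ofNat (N + 1) 0 = 0 := rfl
      rw [this, add_zero]
      rfl
    | succ k ih =>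
      intro x z s
      have : Fin.ofNat (N + 1) (k + 1) = Fin.ofNat (N + 1) k + 1 := by
        ext; simp [Fin.val_add]
      rw [pow_succ, LinearIsometryEquiv.coe_mul, Function.comp_apply, ih, this, ← add_assoc]
      rfl
  refine ⟨Z × Fin (N + 1), inferInstance, τ.symm, weightedEmb p hp C J hC hCJ,
    weightedExp p hp C J hC hCJ, fun f hf => weightedEmb_nonneg hp C J hC hCJ hf,
    fun x hx => weightedExp_nonneg hp C J hC hCJ hx, norm_weightedExp_le hp C J hC hCJ,
    weightedExp_weightedEmb hp C J hC hCJ, ?_⟩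
  intro k f
  change ‖weightedExp p hp C J hC hCJ ((S ^ k) (weightedEmb p hp C J hC hCJ f)) - _‖ ≤ _
  have hexp : weightedExp p hp C J hC hCJ ((S ^ k) (weightedEmb p hp C J hC hCJ f)) - (A ^ k) f
      = (m : 𝕜) • ∑ s : Fin (N + 1), (Y s (X (s + Fin.ofNat (N + 1) k) f) - (A ^ k) f) := by
    have hm : ((N + 1 : ℕ) : 𝕜) * (m : 𝕜) = 1 := by
      have : (N : 𝕜) + 1 ≠ 0 := Nat.cast_add_one_ne_zero N
      simp only [m]; push_cast; field_simp
    rw [Finset.sum_sub_distrib, smul_sub, Finset.sum_const, Finset.card_univ, Fintype.card_fin,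
      ← Nat.cast_smul_eq_nsmul 𝕜, smul_smul, mul_comm (m : 𝕜), hm, one_smul]
    congr 1
    ext i
    rw [weightedExp_apply, Fintype.sum_prod_type_right, PiLp.smul_apply, WithLp.ofLp_sum,
      Finset.sum_apply, Finset.smul_sum]
    refine Finset.sum_congr rfl fun s _ => ?_
    change _ = (m : 𝕜) • ∑ z, _ * ((c _ z : 𝕜) * f (j _ z))
    rw [Finset.smul_sum]
    refine Finset.sum_congr rfl fun z _ => ?_
    rw [hS, weightedEmb_apply]
    simp only [C, J]
    split_ifs
    · rw [← hqdef, dualPow_mul ha0 (hc _ _), ← had, smul_eq_mul]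
      push_cast
      ring
    · simp
  rw [hexp, norm_smul, RCLike.norm_ofReal, abs_of_pos hm0]
  have hterm : ∀ s : Fin (N + 1), ‖Y s (X (s + Fin.ofNat (N + 1) k) f) - (A ^ k) f‖
      ≤ if (s : ℕ) + k ≤ N then 0 else 2 * ‖f‖ := by
    intro s
    split_ifs with h
    · rw [hYX s _ k ?_ f, sub_self, norm_zero]
      rw [Fin.val_add, Fin.val_ofNat, Nat.mod_eq_of_lt (by omega : k < N + 1),
        Nat.mod_eq_of_lt (by omega)]
    · refine (norm_sub_le _ _).trans ?_
      have h1 : ‖Y s (X (s + Fin.ofNat (N + 1) k) f)‖ ≤ ‖f‖ := by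
        have := (Y s).le_of_opNorm_le (norm_weightedExp_le hp _ _ _ _)
          (X (s + Fin.ofNat (N + 1) k) f)
        rwa [one_mul, LinearIsometry.norm_map] at this
      linarith [hAn k f]
  have hcard : (Finset.univ.filter fun s : Fin (N + 1) => ¬ ((s : ℕ) + k ≤ N)).card ≤ k := by
    have h1 : (Finset.univ.filter fun s : Fin (N + 1) => ¬ ((s : ℕ) + k ≤ N)).card
        ≤ (Finset.Ico (N + 1 - k) (N + 1)).card := by
      refine Finset.card_le_card_of_injOn (fun s : Fin (N + 1) => (s : ℕ)) (fun s hs => ?_)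
        fun x _ y _ h => Fin.ext h
      have h2 := s.2
      have h3 := (Finset.mem_filter.1 (Finset.mem_coe.1 hs)).2
      simp only [Finset.coe_Ico, Set.mem_Ico]
      omega
    rw [Nat.card_Ico] at h1
    omega
  have hsum : ‖∑ s : Fin (N + 1), (Y s (X (s + Fin.ofNat (N + 1) k) f) - (A ^ k) f)‖
      ≤ k * (2 * ‖f‖) := by
    refine (norm_sum_le _ _).trans ((Finset.sum_le_sum fun s _ => hterm s).trans ?_)
    rw [Finset.sum_ite, Finset.sum_const_zero, zero_add, Finset.sum_const, nsmul_eq_mul]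
    gcongr
  calc m * _ ≤ m * (k * (2 * ‖f‖)) := by gcongr
    _ = 2 * k / (N + 1) * ‖f‖ := by simp only [m]; field_simp

end FiniteDilation

/-! ### Ultraproducts of normed spaces -/

noncomputable section Ultraproduct

open Filter Topology

variable {𝕜 : Type*} [RCLike 𝕜] {ι : Type*} (U : Ultrafilter ι)
  (F : ι → Type*) [∀ i, NormedAddCommGroup (F i)] [∀ i, NormedSpace 𝕜 (F i)]

/-- The subspace of bounded families whose norms tend to zero along the ultrafilter `U`. -/
def ultraNull (𝕜 : Type*) [RCLike 𝕜] {ι : Type*} (U : Ultrafilter ι)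
    (F : ι → Type*) [∀ i, NormedAddCommGroup (F i)] [∀ i, NormedSpace 𝕜 (F i)] :
    Submodule 𝕜 (lp F ∞) where
  carrier := {g | Tendsto (fun i => ‖g i‖) U (𝓝 0)}
  zero_mem' := by simp
  add_mem' := by
    intro a b ha hb
    refine squeeze_zero (fun i => norm_nonneg _) (fun i => ?_) (by simpa using ha.add hb)
    exact norm_add_le _ _
  smul_mem' := by
    intro c a ha
    have := ha.const_mul ‖c‖
    rw [mul_zero] at this
    refine this.congr fun i => ?_
    simp [norm_smul]

instance isClosed_ultraNull : IsClosed (ultraNull 𝕜 U F : Set (lp F ∞)) := by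
  refine isClosed_of_closure_subset fun g hg => ?_
  change Tendsto (fun i => ‖g i‖) U (𝓝 0)
  rw [Metric.tendsto_nhds]
  intro ε hε
  obtain ⟨h, hh, hd⟩ := Metric.mem_closure_iff.1 hg (ε / 2) (half_pos hε)
  have hh' : Tendsto (fun i => ‖h i‖) U (𝓝 0) := hh
  filter_upwards [(Metric.tendsto_nhds.1 hh') (ε / 2) (half_pos hε)] with i hi
  rw [dist_zero_right, norm_norm] at hi ⊢
  have h1 : ‖(g - h) i‖ ≤ ‖g - h‖ := lp.norm_apply_le_norm ENNReal.top_ne_zero _ i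
  rw [← dist_eq_norm] at h1
  have h2 : ‖g i‖ ≤ ‖(g - h) i‖ + ‖h i‖ := by
    have := norm_add_le ((g - h) i) (h i)
    simpa using this
  linarith

/-- The ultraproduct of a family of normed spaces: bounded families modulo null families. -/
def Ultraprod (𝕜 : Type*) [RCLike 𝕜] {ι : Type*} (U : Ultrafilter ι)
    (F : ι → Type*) [∀ i, NormedAddCommGroup (F i)] [∀ i, NormedSpace 𝕜 (F i)] : Type _ :=
  lp F ∞ ⧸ ultraNull 𝕜 U F

instance : NormedAddCommGroup (Ultraprod 𝕜 U F) :=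
  inferInstanceAs (NormedAddCommGroup (lp F ∞ ⧸ ultraNull 𝕜 U F))

instance : NormedSpace 𝕜 (Ultraprod 𝕜 U F) :=
  inferInstanceAs (NormedSpace 𝕜 (lp F ∞ ⧸ ultraNull 𝕜 U F))

instance [∀ i, CompleteSpace (F i)] : CompleteSpace (Ultraprod 𝕜 U F) :=
  inferInstanceAs (CompleteSpace (lp F ∞ ⧸ ultraNull 𝕜 U F))

variable {F}

/-- A uniformly bounded family, as an element of the space of bounded families. -/
def lpOfBdd (g : ∀ i, F i) (hg : ∃ C, ∀ i, ‖g i‖ ≤ C) : lp F ∞ :=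
  ⟨g, memℓp_infty (by obtain ⟨C, hC⟩ := hg; exact ⟨C, by rintro _ ⟨i, rfl⟩; exact hC i⟩)⟩

/-- The class of a bounded family in the ultraproduct. -/
def ultraMk (𝕜 : Type*) [RCLike 𝕜] {ι : Type*} (U : Ultrafilter ι) {F : ι → Type*}
    [∀ i, NormedAddCommGroup (F i)] [∀ i, NormedSpace 𝕜 (F i)]
    (g : ∀ i, F i) (hg : ∃ C, ∀ i, ‖g i‖ ≤ C) : Ultraprod 𝕜 U F :=
  Submodule.Quotient.mk (lpOfBdd g hg)

theorem bddFamily_coe {ι : Type*} {F : ι → Type*} [∀ i, NormedAddCommGroup (F i)] (g : lp F ∞) :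
    ∃ C, ∀ i, ‖g i‖ ≤ C :=
  ⟨‖g‖, fun i => lp.norm_apply_le_norm ENNReal.top_ne_zero _ i⟩

theorem ultraMk_surjective (x : Ultraprod 𝕜 U F) : ∃ g hg, ultraMk 𝕜 U g hg = x := by
  obtain ⟨g, rfl⟩ := Submodule.Quotient.mk_surjective _ x
  exact ⟨g, bddFamily_coe g, rfl⟩

theorem ultraMk_eq_iff {g h : ∀ i, F i} {hg hh} :
    ultraMk 𝕜 U g hg = ultraMk 𝕜 U h hh ↔ Tendsto (fun i => ‖g i - h i‖) U (𝓝 0) :=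
  Submodule.Quotient.eq _

theorem ultraMk_add {g h : ∀ i, F i} (hg hh hgh) :
    ultraMk 𝕜 U (fun i => g i + h i) hgh = ultraMk 𝕜 U g hg + ultraMk 𝕜 U h hh := rfl

theorem ultraMk_smul {g : ∀ i, F i} (c : 𝕜) (hg hgh) :
    ultraMk 𝕜 U (fun i => c • g i) hgh = c • ultraMk 𝕜 U g hg := rfl

/-- The quotient norm of a class is the limit of the norms of any representing family: the
family may be set to zero outside a set of `U` on which its norms are close to the limit. -/
theorem tendsto_norm_ultraMk (g : ∀ i, F i) (hg : ∃ C, ∀ i, ‖g i‖ ≤ C) :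
    Tendsto (fun i => ‖g i‖) U (𝓝 ‖ultraMk 𝕜 U g hg‖) := by
  classical
  obtain ⟨C, hC⟩ := hg
  have hcpt : IsCompact (Set.Icc 0 C) := isCompact_Icc
  obtain ⟨l, -, hl⟩ := hcpt.ultrafilter_le_nhds (U.map fun i => ‖g i‖) (by
    rw [le_principal_iff]
    exact Filter.mem_map.2 (Filter.univ_mem' fun i => ⟨norm_nonneg _, hC i⟩))
  have hl : Tendsto (fun i => ‖g i‖) U (𝓝 l) := hl
  have hl0 : 0 ≤ l := ge_of_tendsto' hl fun i => norm_nonneg _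
  suffices h : ‖ultraMk 𝕜 U g ⟨C, hC⟩‖ = l by rw [h]; exact hl
  apply le_antisymm
  · refine le_of_forall_pos_le_add fun ε hε => ?_
    have hev : ∀ᶠ i in U, ‖g i‖ < l + ε := hl.eventually_lt_const (by linarith)
    let g' : ∀ i, F i := fun i => if ‖g i‖ < l + ε then g i else 0
    have hg' : ∀ i, ‖g' i‖ ≤ l + ε := by
      intro i
      by_cases h : ‖g i‖ < l + ε
      · simp only [g', if_pos h]; exact h.le
      · simp only [g', if_neg h, norm_zero]; positivity
    have : ultraMk 𝕜 U g ⟨C, hC⟩ = ultraMk 𝕜 U g' ⟨_, hg'⟩ := by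
      rw [ultraMk_eq_iff]
      refine tendsto_const_nhds.congr' ?_
      filter_upwards [hev] with i hi
      simp only [g', if_pos hi, sub_self, norm_zero]
    rw [this]
    refine le_trans (Submodule.Quotient.norm_mk_le (S := ultraNull 𝕜 U F) (lpOfBdd g' ⟨_, hg'⟩)) ?_
    exact lp.norm_le_of_forall_le (by positivity) hg'
  · refine le_of_forall_pos_le_add fun ε hε => ?_
    obtain ⟨h, hh, hlt⟩ := Submodule.Quotient.norm_mk_lt (S := ultraNull 𝕜 U F)
      (ultraMk 𝕜 U g ⟨C, hC⟩) hε
    have hnull : Tendsto (fun i => ‖g i - h i‖) U (𝓝 0) := by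
      have : ultraMk 𝕜 U g ⟨C, hC⟩ = ultraMk 𝕜 U h (bddFamily_coe h) := hh.symm
      rwa [ultraMk_eq_iff] at this
    refine (le_of_tendsto' (by simpa using hl.sub hnull) fun i => ?_ : l ≤ ‖h‖).trans hlt.le
    have h1 : ‖h i‖ ≤ ‖h‖ := lp.norm_apply_le_norm ENNReal.top_ne_zero _ i
    have h2 : ‖g i‖ ≤ ‖g i - h i‖ + ‖h i‖ := by simpa using norm_add_le (g i - h i) (h i)
    linarith

theorem norm_ultraMk_eq_of_tendsto {g : ∀ i, F i} {hg} {l : ℝ}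
    (h : Tendsto (fun i => ‖g i‖) U (𝓝 l)) : ‖ultraMk 𝕜 U g hg‖ = l :=
  tendsto_nhds_unique (tendsto_norm_ultraMk U g hg) h

theorem norm_ultraMk_le {g h : ∀ i, F i} {hg hh} (hgh : ∀ i, ‖g i‖ ≤ ‖h i‖) :
    ‖ultraMk 𝕜 U g hg‖ ≤ ‖ultraMk 𝕜 U h hh‖ :=
  le_of_tendsto_of_tendsto' (tendsto_norm_ultraMk U g hg) (tendsto_norm_ultraMk U h hh) hgh

theorem bddFamily_of_le {ι : Type*} {F : ι → Type*} [∀ i, NormedAddCommGroup (F i)]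
    {g h : ∀ i, F i} (hh : ∃ C, ∀ i, ‖h i‖ ≤ C) (hgh : ∀ i, ‖g i‖ ≤ ‖h i‖) :
    ∃ C, ∀ i, ‖g i‖ ≤ C := by
  obtain ⟨C, hC⟩ := hh
  exact ⟨C, fun i => (hgh i).trans (hC i)⟩

theorem norm_apply_le_of_norm_le_one {V W : Type*} [NormedAddCommGroup V] [NormedSpace 𝕜 V]
    [NormedAddCommGroup W] [NormedSpace 𝕜 W] {L : V →L[𝕜] W} (hL : ‖L‖ ≤ 1) (x : V) :
    ‖L x‖ ≤ ‖x‖ := by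
  simpa using L.le_of_opNorm_le hL x

/-- A family of contractions of the factors acts on the ultraproduct. -/
def ultraMap (L : ∀ i, F i →L[𝕜] F i) (hL : ∀ i, ‖L i‖ ≤ 1) :
    Ultraprod 𝕜 U F →L[𝕜] Ultraprod 𝕜 U F :=
  LinearMap.mkContinuous
    ((ultraNull 𝕜 U F).mapQ (ultraNull 𝕜 U F)
      { toFun := fun g => lpOfBdd (fun i => L i (g i))
          (bddFamily_of_le (bddFamily_coe g) fun i => norm_apply_le_of_norm_le_one (hL i) _)
        map_add' := by intro g h; ext i; exact map_add (L i) _ _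
        map_smul' := by intro c g; ext i; exact map_smul (L i) _ _ }
      (by
        intro g hg
        exact squeeze_zero (fun i => norm_nonneg _)
          (fun i => norm_apply_le_of_norm_le_one (hL i) _) hg)) 1
    (by
      intro x
      obtain ⟨g, hg, rfl⟩ := ultraMk_surjective U x
      rw [one_mul]
      exact norm_ultraMk_le U (hg := bddFamily_of_le hg fun i =>
        norm_apply_le_of_norm_le_one (hL i) _) fun i => norm_apply_le_of_norm_le_one (hL i) _)

theorem ultraMap_mk (L : ∀ i, F i →L[𝕜] F i) (hL : ∀ i, ‖L i‖ ≤ 1) (g : ∀ i, F i) (hg hg') :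
    ultraMap U L hL (ultraMk 𝕜 U g hg) = ultraMk 𝕜 U (fun i => L i (g i)) hg' := rfl

theorem norm_ultraMap_le (L : ∀ i, F i →L[𝕜] F i) (hL : ∀ i, ‖L i‖ ≤ 1) :
    ‖ultraMap U L hL‖ ≤ 1 :=
  LinearMap.mkContinuous_norm_le _ zero_le_one _

/-- A family of isometric automorphisms of the factors acts on the ultraproduct. -/
def ultraIso (L : ∀ i, F i ≃ₗᵢ[𝕜] F i) : Ultraprod 𝕜 U F ≃ₗᵢ[𝕜] Ultraprod 𝕜 U F :=
  LinearIsometryEquiv.ofSurjective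
    { toLinearMap := (ultraMap U (fun i => (L i).toLinearIsometry.toContinuousLinearMap)
        fun i => (L i).toLinearIsometry.norm_toContinuousLinearMap_le).toLinearMap
      norm_map' := by
        intro x
        obtain ⟨g, hg, rfl⟩ := ultraMk_surjective U x
        change ‖ultraMk 𝕜 U (fun i => L i (g i)) (by simpa using hg)‖ = _
        refine norm_ultraMk_eq_of_tendsto U ?_
        simpa using tendsto_norm_ultraMk U g hg }
    (by
      intro x
      obtain ⟨g, hg, rfl⟩ := ultraMk_surjective U x
      refine ⟨ultraMk 𝕜 U (fun i => (L i).symm (g i)) (by simpa using hg), ?_⟩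
      change ultraMk 𝕜 U (fun i => L i ((L i).symm (g i))) (by simpa using hg) = _
      rw [ultraMk_eq_iff]
      simp)

theorem ultraIso_pow_mk (L : ∀ i, F i ≃ₗᵢ[𝕜] F i) (k : ℕ) (g : ∀ i, F i) (hg hg') :
    (ultraIso U L ^ k) (ultraMk 𝕜 U g hg) = ultraMk 𝕜 U (fun i => (L i ^ k) (g i)) hg' := by
  induction k with
  | zero => rfl
  | succ k ih =>
    have hk : ∃ C, ∀ i, ‖(L i ^ k) (g i)‖ ≤ C := by simpa using hg
    simp only [pow_succ', LinearIsometryEquiv.coe_mul, Function.comp_apply, ih hk]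
    rfl

/-- A family of contractions into the factors, whose norms at each vector tend to the norm of
that vector, yields an isometric embedding into the ultraproduct. -/
def ultraEmb {E : Type*} [NormedAddCommGroup E] [NormedSpace 𝕜 E] (L : ∀ i, E →L[𝕜] F i)
    (hL : ∀ i, ‖L i‖ ≤ 1) (hlim : ∀ x, Tendsto (fun i => ‖L i x‖) U (𝓝 ‖x‖)) :
    E →ₗᵢ[𝕜] Ultraprod 𝕜 U F where
  toFun x := ultraMk 𝕜 U (fun i => L i x) ⟨‖x‖, fun i => norm_apply_le_of_norm_le_one (hL i) x⟩
  map_add' x y := by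
    rw [← ultraMk_add U _ _ ⟨‖x‖ + ‖y‖, fun i => (norm_add_le _ _).trans (add_le_add
        (norm_apply_le_of_norm_le_one (hL i) x) (norm_apply_le_of_norm_le_one (hL i) y))⟩]
    simp
  map_smul' c x := by
    rw [RingHom.id_apply, ← ultraMk_smul U c _ ⟨‖c‖ * ‖x‖, fun i => by
        rw [norm_smul]
        exact mul_le_mul_of_nonneg_left (norm_apply_le_of_norm_le_one (hL i) x) (norm_nonneg c)⟩]
    simp
  norm_map' x := norm_ultraMk_eq_of_tendsto U (hlim x)

end Ultraproduct

/-! ### Ultraproducts of finite-dimensional `ℓ^p` spaces -/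

noncomputable section UltraprodLp

open Filter Topology

variable {𝕜 : Type*} [RCLike 𝕜] {ι : Type*} {κ : ι → Type*} [∀ i, Fintype (κ i)]

/-- The restrictions of a function on the disjoint union of the finite sets `κ i` to these sets. -/
def slice (p : ℝ≥0∞) (g : (Σ i, κ i) → 𝕜) (i : ι) : PiLp p (fun _ : κ i => 𝕜) :=
  WithLp.toLp p fun z => g ⟨i, z⟩

variable (p : ℝ≥0∞) [Fact (1 ≤ p)]

/-- The restrictions of the function have uniformly bounded `ℓ^p`-norms. -/
def SliceBdd (g : (Σ i, κ i) → 𝕜) : Prop := ∃ C, ∀ i, ‖slice p g i‖ ≤ C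

/-- The ultraproduct of the spaces `ℓ^p (κ i)`. -/
abbrev UltraLp (𝕜 : Type*) [RCLike 𝕜] {ι : Type*} (U : Ultrafilter ι) (κ : ι → Type*)
    [∀ i, Fintype (κ i)] (p : ℝ≥0∞) [Fact (1 ≤ p)] : Type _ :=
  Ultraprod 𝕜 U fun i => PiLp p (fun _ : κ i => 𝕜)

open Classical in
/-- The element of the ultraproduct represented by a function with uniformly bounded slices
(zero, if the slices are not bounded). -/
def cls (U : Ultrafilter ι) (g : (Σ i, κ i) → 𝕜) : UltraLp 𝕜 U κ p :=
  if h : SliceBdd p g then ultraMk 𝕜 U (slice p g) h else 0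

variable {p}

theorem norm_slice_le (hp : p ≠ ∞) {g h : (Σ i, κ i) → 𝕜} (hgh : ∀ z, ‖g z‖ ≤ ‖h z‖) (i : ι) :
    ‖slice p g i‖ ≤ ‖slice p h i‖ := by
  apply PiLp.norm_le_of_sum_rpow_le hp
  have := one_le_toReal_of_fact hp
  exact Finset.sum_le_sum fun z _ => Real.rpow_le_rpow (norm_nonneg _) (hgh _) (by linarith)

theorem SliceBdd.mono (hp : p ≠ ∞) {g h : (Σ i, κ i) → 𝕜} (hh : SliceBdd p h)
    (hgh : ∀ z, ‖g z‖ ≤ ‖h z‖) : SliceBdd p g :=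
  bddFamily_of_le hh (norm_slice_le hp hgh)

theorem sliceBdd_zero : SliceBdd p (fun _ : Σ i, κ i => (0 : 𝕜)) :=
  ⟨0, fun i => by
    have : slice p (fun _ : Σ i, κ i => (0 : 𝕜)) i = 0 := rfl
    rw [this, norm_zero]⟩

theorem SliceBdd.add {g h : (Σ i, κ i) → 𝕜} (hg : SliceBdd p g) (hh : SliceBdd p h) :
    SliceBdd p (fun z => g z + h z) := by
  obtain ⟨C, hC⟩ := hg
  obtain ⟨D, hD⟩ := hh
  exact ⟨C + D, fun i => (norm_add_le (slice p g i) (slice p h i)).trans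
    (add_le_add (hC i) (hD i))⟩

theorem SliceBdd.const_mul {g : (Σ i, κ i) → 𝕜} (hg : SliceBdd p g) (c : 𝕜) :
    SliceBdd p (fun z => c * g z) := by
  obtain ⟨C, hC⟩ := hg
  refine ⟨‖c‖ * C, fun i => ?_⟩
  have : slice p (fun z => c * g z) i = c • slice p g i := rfl
  rw [this, norm_smul]
  exact mul_le_mul_of_nonneg_left (hC i) (norm_nonneg c)

theorem SliceBdd.sub {g h : (Σ i, κ i) → 𝕜} (hg : SliceBdd p g) (hh : SliceBdd p h) :
    SliceBdd p (fun z => g z - h z) := by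
  have := hg.add (hh.const_mul (-1))
  simpa [sub_eq_add_neg] using this

theorem SliceBdd.bdd_mul (hp : p ≠ ∞) {b g : (Σ i, κ i) → 𝕜} (hg : SliceBdd p g) {C : ℝ}
    (hb : ∀ z, ‖b z‖ ≤ C) : SliceBdd p (fun z => b z * g z) := by
  refine (hg.const_mul (C : 𝕜)).mono hp fun z => ?_
  rw [norm_mul, norm_mul, RCLike.norm_ofReal]
  exact mul_le_mul_of_nonneg_right ((hb z).trans (le_abs_self C)) (norm_nonneg _)

theorem SliceBdd.sum {A : Type*} (F : Finset A) {g : A → (Σ i, κ i) → 𝕜}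
    (hg : ∀ a ∈ F, SliceBdd p (g a)) : SliceBdd p (fun z => ∑ a ∈ F, g a z) := by
  classical
  induction F using Finset.induction_on with
  | empty => simpa using sliceBdd_zero
  | insert a F ha ih =>
    have := (hg a (Finset.mem_insert_self a F)).add
      (ih fun b hb => hg b (Finset.mem_insert_of_mem hb))
    simpa [Finset.sum_insert ha] using this

variable (U : Ultrafilter ι)

theorem cls_of_bdd {g : (Σ i, κ i) → 𝕜} (hg : SliceBdd p g) :
    cls p U g = ultraMk 𝕜 U (slice p g) hg := dif_pos hg

theorem exists_cls_eq (x : UltraLp 𝕜 U κ p) : ∃ g, SliceBdd p g ∧ cls p U g = x := by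
  obtain ⟨g, hg, rfl⟩ := ultraMk_surjective U x
  have hs : slice p (fun z : Σ i, κ i => g z.1 z.2) = g := rfl
  have h : SliceBdd p (fun z : Σ i, κ i => g z.1 z.2) := by rw [SliceBdd, hs]; exact hg
  exact ⟨_, h, cls_of_bdd U h⟩

theorem cls_add {g h : (Σ i, κ i) → 𝕜} (hg : SliceBdd p g) (hh : SliceBdd p h) :
    cls p U (fun z => g z + h z) = cls p U g + cls p U h := by
  rw [cls_of_bdd U hg, cls_of_bdd U hh, cls_of_bdd U (hg.add hh)]
  rfl

theorem cls_sub {g h : (Σ i, κ i) → 𝕜} (hg : SliceBdd p g) (hh : SliceBdd p h) :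
    cls p U (fun z => g z - h z) = cls p U g - cls p U h := by
  rw [cls_of_bdd U hg, cls_of_bdd U hh, cls_of_bdd U (hg.sub hh)]
  rfl

theorem cls_const_mul {g : (Σ i, κ i) → 𝕜} (hg : SliceBdd p g) (c : 𝕜) :
    cls p U (fun z => c * g z) = c • cls p U g := by
  rw [cls_of_bdd U hg, cls_of_bdd U (hg.const_mul c)]
  rfl

theorem cls_zero : cls p U (fun _ : Σ i, κ i => (0 : 𝕜)) = 0 := by
  have := cls_const_mul U (sliceBdd_zero (p := p) (𝕜 := 𝕜) (κ := κ)) 0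
  simpa using this

theorem cls_sum {A : Type*} (F : Finset A) {g : A → (Σ i, κ i) → 𝕜}
    (hg : ∀ a ∈ F, SliceBdd p (g a)) :
    cls p U (fun z => ∑ a ∈ F, g a z) = ∑ a ∈ F, cls p U (g a) := by
  classical
  induction F using Finset.induction_on with
  | empty => simpa using cls_zero U
  | insert a F ha ih =>
    have h1 := fun b hb => hg b (Finset.mem_insert_of_mem hb)
    simp only [Finset.sum_insert ha]
    rw [← ih h1, ← cls_add U (hg a (Finset.mem_insert_self a F)) (SliceBdd.sum F h1)]

theorem norm_cls_le (hp : p ≠ ∞) {g h : (Σ i, κ i) → 𝕜} (hh : SliceBdd p h)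
    (hgh : ∀ z, ‖g z‖ ≤ ‖h z‖) : ‖cls p U g‖ ≤ ‖cls p U h‖ := by
  rw [cls_of_bdd U hh, cls_of_bdd U (hh.mono hp hgh)]
  exact norm_ultraMk_le U (norm_slice_le hp hgh)

theorem cls_eq_zero_of_le (hp : p ≠ ∞) {g h : (Σ i, κ i) → 𝕜} (hh : SliceBdd p h)
    (hgh : ∀ z, ‖g z‖ ≤ ‖h z‖) (h0 : cls p U h = 0) : cls p U g = 0 := by
  have := norm_cls_le U hp hh hgh
  rw [h0, norm_zero] at this
  exact norm_le_zero_iff.1 this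

theorem cls_eq_of_sub {g h : (Σ i, κ i) → 𝕜} (hg : SliceBdd p g) (hh : SliceBdd p h)
    (h0 : cls p U (fun z => g z - h z) = 0) : cls p U g = cls p U h := by
  rw [cls_sub U hg hh] at h0
  exact sub_eq_zero.1 h0

theorem norm_cls_bdd_mul_le (hp : p ≠ ∞) {b g : (Σ i, κ i) → 𝕜} (hg : SliceBdd p g) {C : ℝ}
    (hC : 0 ≤ C) (hb : ∀ z, ‖b z‖ ≤ C) : ‖cls p U (fun z => b z * g z)‖ ≤ C * ‖cls p U g‖ := by
  have h1 : ‖cls p U (fun z => b z * g z)‖ ≤ ‖cls p U (fun z => (C : 𝕜) * g z)‖ := by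
    refine norm_cls_le U hp (hg.const_mul _) fun z => ?_
    rw [norm_mul, norm_mul, RCLike.norm_ofReal, abs_of_nonneg hC]
    exact mul_le_mul_of_nonneg_right (hb z) (norm_nonneg _)
  rwa [cls_const_mul U hg, norm_smul, RCLike.norm_ofReal, abs_of_nonneg hC] at h1

theorem tendsto_sum_norm_rpow (hp : p ≠ ∞) {g : (Σ i, κ i) → 𝕜} (hg : SliceBdd p g) :
    Tendsto (fun i => ∑ z, ‖g ⟨i, z⟩‖ ^ p.toReal) U (𝓝 (‖cls p U g‖ ^ p.toReal)) := by
  rw [cls_of_bdd U hg]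
  have h := (tendsto_norm_ultraMk (𝕜 := 𝕜) U (slice p g) hg).rpow_const (p := p.toReal)
    (Or.inr (by have := one_le_toReal_of_fact hp; linarith))
  refine h.congr fun i => ?_
  rw [PiLp.norm_rpow_toReal hp]
  rfl

/-- Superadditivity of the `p`-th power of the norm on nonnegative elements. -/
theorem norm_cls_add_rpow_le (hp : p ≠ ∞) {g h : (Σ i, κ i) → ℝ}
    (hg : SliceBdd p (fun z => (g z : 𝕜))) (hh : SliceBdd p (fun z => (h z : 𝕜)))
    (hg0 : ∀ z, 0 ≤ g z) (hh0 : ∀ z, 0 ≤ h z) :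
    ‖cls p U (fun z => (g z : 𝕜))‖ ^ p.toReal + ‖cls p U (fun z => (h z : 𝕜))‖ ^ p.toReal
      ≤ ‖cls p U (fun z => (g z : 𝕜) + (h z : 𝕜))‖ ^ p.toReal := by
  refine le_of_tendsto_of_tendsto'
    ((tendsto_sum_norm_rpow U hp hg).add (tendsto_sum_norm_rpow U hp hh))
    (tendsto_sum_norm_rpow U hp (hg.add hh)) fun i => ?_
  rw [← Finset.sum_add_distrib]
  refine Finset.sum_le_sum fun z _ => ?_
  rw [← RCLike.ofReal_add, RCLike.norm_ofReal, RCLike.norm_ofReal, RCLike.norm_ofReal,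
    abs_of_nonneg (hg0 _), abs_of_nonneg (hh0 _), abs_of_nonneg (add_nonneg (hg0 _) (hh0 _))]
  exact Real.add_rpow_le_rpow_add (hg0 _) (hh0 _) (one_le_toReal_of_fact hp)

/-- Nonnegative functions whose pairwise minima represent zero in the ultraproduct. -/
structure AsympDisjoint (𝕜 : Type*) [RCLike 𝕜] (p : ℝ≥0∞) [Fact (1 ≤ p)] (U : Ultrafilter ι)
    {A : Type*} (e : A → (Σ i, κ i) → ℝ) : Prop where
  nonneg : ∀ a z, 0 ≤ e a z
  bdd : ∀ a, SliceBdd p (fun z => (e a z : 𝕜))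
  disj : ∀ a b, a ≠ b → cls p U (fun z => ((min (e a z) (e b z) : ℝ) : 𝕜)) = 0

/-- There is a maximal asymptotically disjoint family: only the zero element is disjoint from
all its members. -/
theorem exists_maximal_asympDisjoint {ι : Type u} {κ : ι → Type u} [∀ i, Fintype (κ i)]
    (𝕜 : Type*) [RCLike 𝕜] (p : ℝ≥0∞) [Fact (1 ≤ p)] (U : Ultrafilter ι) :
    ∃ (A : Type u) (e : A → (Σ i, κ i) → ℝ), AsympDisjoint 𝕜 p U e ∧
      ∀ r : (Σ i, κ i) → ℝ, (∀ z, 0 ≤ r z) → SliceBdd p (fun z => (r z : 𝕜)) →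
        (∀ a, cls p U (fun z => ((min (r z) (e a z) : ℝ) : 𝕜)) = 0) →
        cls p U (fun z => (r z : 𝕜)) = 0 := by
  let P : Set (Set ((Σ i, κ i) → ℝ)) := {m | AsympDisjoint 𝕜 p U (fun a : m => a.1)}
  obtain ⟨m, hm⟩ := zorn_subset P (by
    intro c hc hchain
    refine ⟨⋃₀ c, ?_, fun s hs => Set.subset_sUnion_of_mem hs⟩
    refine ⟨?_, ?_, ?_⟩
    · rintro ⟨a, s, hs, ha⟩
      exact (hc hs).nonneg ⟨a, ha⟩
    · rintro ⟨a, s, hs, ha⟩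
      exact (hc hs).bdd ⟨a, ha⟩
    · rintro ⟨a, s, hs, ha⟩ ⟨b, t, ht, hb⟩ hab
      have hab' : a ≠ b := fun h => hab (Subtype.ext h)
      rcases hchain.total hs ht with h | h
      · exact (hc ht).disj ⟨a, h ha⟩ ⟨b, hb⟩ fun h' => hab' (congrArg Subtype.val h')
      · exact (hc hs).disj ⟨a, ha⟩ ⟨b, h hb⟩ fun h' => hab' (congrArg Subtype.val h'))
  refine ⟨m, fun a => a.1, hm.prop, fun r hr0 hr hdisj => ?_⟩
  have hin : insert r m ∈ P := by
    refine ⟨?_, ?_, ?_⟩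
    · rintro ⟨a, rfl | ha⟩
      · exact hr0
      · exact hm.prop.nonneg ⟨a, ha⟩
    · rintro ⟨a, rfl | ha⟩
      · exact hr
      · exact hm.prop.bdd ⟨a, ha⟩
    · rintro ⟨a, rfl | ha⟩ ⟨b, rfl | hb⟩ hab
      · exact absurd rfl hab
      · exact hdisj ⟨b, hb⟩
      · have := hdisj ⟨a, ha⟩
        simpa only [min_comm] using this
      · exact hm.prop.disj ⟨a, ha⟩ ⟨b, hb⟩ fun h' => hab (Subtype.ext (Subtype.mk.inj h'))
  have hrm : r ∈ m := hm.le_of_ge hin (Set.subset_insert r m) (Set.mem_insert r m)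
  have := hdisj ⟨r, hrm⟩
  simpa using this

open Classical in
/-- The function `e a`, restricted to the points where it dominates strictly all other members of
a finite family. These restrictions are disjoint, and represent the same elements of the
ultraproduct as the original functions if these are asymptotically disjoint. -/
def sharpen {A X : Type*} (e : A → X → ℝ) (F : Finset A) (a : A) (z : X) : ℝ :=
  if ∀ b ∈ F, b ≠ a → e b z < e a z then e a z else 0

theorem sharpen_eq_zero_or {A X : Type*} (e : A → X → ℝ) {F : Finset A} {a b : A} (ha : a ∈ F)
    (hb : b ∈ F) (hab : a ≠ b) (z : X) : sharpen e F a z = 0 ∨ sharpen e F b z = 0 := by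
  unfold sharpen
  split_ifs with h1 h2
  · exact absurd ((h1 b hb hab.symm).trans (h2 a ha hab)) (lt_irrefl _)
  all_goals simp

namespace AsympDisjoint

variable {U} {A : Type*} {e : A → (Σ i, κ i) → ℝ} (he : AsympDisjoint 𝕜 p U e)

include he

theorem sharpen_bdd (hp : p ≠ ∞) (F : Finset A) (a : A) :
    SliceBdd p (fun z => (sharpen e F a z : 𝕜)) := by
  refine (he.bdd a).mono hp fun z => ?_
  unfold sharpen
  split_ifs
  · exact le_rfl
  · simp

theorem bdd_mul (hp : p ≠ ∞) (a : A) {h : (Σ i, κ i) → 𝕜} {C : ℝ} (hh : ∀ z, ‖h z‖ ≤ C) :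
    SliceBdd p (fun z => h z * (e a z : 𝕜)) := (he.bdd a).bdd_mul hp hh

theorem cls_mul_sharpen (hp : p ≠ ∞) (F : Finset A) (a : A) {h : (Σ i, κ i) → 𝕜} {C : ℝ}
    (hh : ∀ z, ‖h z‖ ≤ C) :
    cls p U (fun z => h z * (e a z : 𝕜)) = cls p U (fun z => h z * (sharpen e F a z : 𝕜)) := by
  classical
  refine cls_eq_of_sub U (he.bdd_mul hp a hh) ((he.sharpen_bdd hp F a).bdd_mul hp hh) ?_
  have hb : ∀ b ∈ F.erase a, SliceBdd p (fun z => ((min (e a z) (e b z) : ℝ) : 𝕜)) := by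
    intro b _
    refine (he.bdd a).mono hp fun z => ?_
    rw [RCLike.norm_ofReal, RCLike.norm_ofReal, abs_of_nonneg (he.nonneg a z),
      abs_of_nonneg (le_min (he.nonneg a z) (he.nonneg b z))]
    exact min_le_left _ _
  have hz : cls p U (fun z => ∑ b ∈ F.erase a, ((min (e a z) (e b z) : ℝ) : 𝕜)) = 0 := by
    rw [cls_sum U _ hb]
    exact Finset.sum_eq_zero fun b hb' => he.disj a b (Finset.ne_of_mem_erase hb').symm
  refine cls_eq_zero_of_le U hp ((SliceBdd.sum _ hb).const_mul (C : 𝕜)) (fun z => ?_)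
    (by rw [cls_const_mul U (SliceBdd.sum _ hb), hz, smul_zero])
  have hC : 0 ≤ C := (norm_nonneg _).trans (hh z)
  have hnn : ∀ b, 0 ≤ min (e a z) (e b z) := fun b => le_min (he.nonneg a z) (he.nonneg b z)
  rw [← mul_sub, norm_mul, norm_mul, RCLike.norm_ofReal, abs_of_nonneg hC, ← RCLike.ofReal_sub,
    ← RCLike.ofReal_sum, RCLike.norm_ofReal, RCLike.norm_ofReal,
    abs_of_nonneg (Finset.sum_nonneg fun b _ => hnn b)]
  refine mul_le_mul (hh z) ?_ (abs_nonneg _) hC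
  unfold sharpen
  split_ifs with hs
  · rw [sub_self, abs_zero]
    exact Finset.sum_nonneg fun b _ => hnn b
  · push Not at hs
    obtain ⟨b, hbF, hba, hle⟩ := hs
    rw [sub_zero, abs_of_nonneg (he.nonneg a z)]
    refine (le_of_eq (min_eq_left hle).symm).trans ?_
    exact Finset.single_le_sum (f := fun b => min (e a z) (e b z)) (fun b _ => hnn b)
      (Finset.mem_erase.2 ⟨hba, hbF⟩)

theorem cls_sum_mul_sharpen (hp : p ≠ ∞) (F : Finset A) {h : A → (Σ i, κ i) → 𝕜} {C : ℝ}
    (hh : ∀ a z, ‖h a z‖ ≤ C) :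
    cls p U (fun z => ∑ a ∈ F, h a z * (e a z : 𝕜))
      = cls p U (fun z => ∑ a ∈ F, h a z * (sharpen e F a z : 𝕜)) := by
  rw [cls_sum U F fun a _ => he.bdd_mul hp a (hh a),
    cls_sum U F fun a _ => (he.sharpen_bdd hp F a).bdd_mul hp (hh a)]
  exact Finset.sum_congr rfl fun a _ => he.cls_mul_sharpen hp F a (hh a)

end AsympDisjoint

/-- A function vanishing at zero commutes with sums that have at most one nonzero term. -/
theorem map_sum_of_disjoint {A M N : Type*} [AddCommMonoid M] [AddCommMonoid N] (φ : M → N)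
    (φ0 : φ 0 = 0) (F : Finset A) (x : A → M)
    (hx : ∀ a ∈ F, ∀ b ∈ F, a ≠ b → x a = 0 ∨ x b = 0) :
    φ (∑ a ∈ F, x a) = ∑ a ∈ F, φ (x a) := by
  classical
  by_cases h : ∃ a ∈ F, x a ≠ 0
  · obtain ⟨a, ha, hxa⟩ := h
    have h0 : ∀ b ∈ F, b ≠ a → x b = 0 := fun b hb hba =>
      ((hx a ha b hb hba.symm).resolve_left hxa)
    rw [Finset.sum_eq_single_of_mem a ha h0, Finset.sum_eq_single_of_mem a ha fun b hb hba => by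
      rw [h0 b hb hba, φ0]]
  · push Not at h
    rw [Finset.sum_eq_zero h, φ0, Finset.sum_eq_zero fun a ha => by rw [h a ha, φ0]]

/-- The `p`-th power of the norm is additive over an asymptotically disjoint family. -/
theorem AsympDisjoint.norm_cls_sum_rpow {U : Ultrafilter ι} {A : Type*} {e : A → (Σ i, κ i) → ℝ}
    (he : AsympDisjoint 𝕜 p U e) (hp : p ≠ ∞) (F : Finset A) {h : A → (Σ i, κ i) → 𝕜} {C : ℝ}
    (hh : ∀ a z, ‖h a z‖ ≤ C) :
    ‖cls p U (fun z => ∑ a ∈ F, h a z * (e a z : 𝕜))‖ ^ p.toReal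
      = ∑ a ∈ F, ‖cls p U (fun z => h a z * (e a z : 𝕜))‖ ^ p.toReal := by
  have hb : ∀ a, SliceBdd p (fun z => h a z * (sharpen e F a z : 𝕜)) :=
    fun a => (he.sharpen_bdd hp F a).bdd_mul hp (hh a)
  have hq := one_le_toReal_of_fact hp
  have h3 : ∑ a ∈ F, ‖cls p U (fun z => h a z * (e a z : 𝕜))‖ ^ p.toReal
      = ∑ a ∈ F, ‖cls p U (fun z => h a z * (sharpen e F a z : 𝕜))‖ ^ p.toReal :=
    Finset.sum_congr rfl fun a _ => by rw [he.cls_mul_sharpen hp F a (hh a)]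
  have hsum : SliceBdd p (fun z => ∑ a ∈ F, h a z * (sharpen e F a z : 𝕜)) :=
    SliceBdd.sum F (g := fun a z => h a z * (sharpen e F a z : 𝕜)) fun a _ => hb a
  rw [he.cls_sum_mul_sharpen hp F hh, h3]
  have h1 := tendsto_sum_norm_rpow U hp hsum
  have h1a := fun a => tendsto_sum_norm_rpow U hp (hb a)
  have h2 := tendsto_finsetSum F fun a _ => h1a a
  have h4 : ∀ i, ∑ a ∈ F, ∑ z, ‖h a ⟨i, z⟩ * (sharpen e F a ⟨i, z⟩ : 𝕜)‖ ^ p.toReal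
      = ∑ z, ‖∑ a ∈ F, h a ⟨i, z⟩ * (sharpen e F a ⟨i, z⟩ : 𝕜)‖ ^ p.toReal := by
    intro i
    rw [Finset.sum_comm]
    refine Finset.sum_congr rfl fun z _ => ?_
    refine (map_sum_of_disjoint (fun x : 𝕜 => ‖x‖ ^ p.toReal)
      (by simp [Real.zero_rpow (by linarith : p.toReal ≠ 0)]) F _ fun a ha b hb hab => ?_).symm
    rcases sharpen_eq_zero_or e ha hb hab (⟨i, z⟩ : Σ i, κ i) with h0 | h0
    · left; rw [h0, RCLike.ofReal_zero, mul_zero]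
    · right; rw [h0, RCLike.ofReal_zero, mul_zero]
  exact tendsto_nhds_unique h1 (h2.congr h4)

end UltraprodLp

/-! ### The representing measure -/

noncomputable section Representation

open Filter Topology CompactlySupported

section Pairing

variable {A Z E : Type*} [TopologicalSpace A]

/-- A compactly supported continuous function on the disjoint union of copies of a space, indexed
by `A`, vanishes on all but finitely many copies. -/
theorem exists_finset_support [DiscreteTopology A] {X : Type*} [TopologicalSpace X]
    [TopologicalSpace E] [Zero E]
    (h : C_c(A × X, E)) : ∃ F : Finset A, ∀ a ∉ F, ∀ x, h (a, x) = 0 := by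
  have hfin : (Prod.fst '' tsupport h : Set A).Finite :=
    (h.hasCompactSupport.isCompact.image continuous_fst).finite_of_discrete
  refine ⟨hfin.toFinset, fun a ha x => ?_⟩
  by_contra hne
  exact ha (hfin.mem_toFinset.2 ⟨(a, x), subset_tsupport _ hne, rfl⟩)

theorem exists_norm_le [NormedAddCommGroup E] {X : Type*} [TopologicalSpace X] (h : C_c(X, E)) :
    ∃ C, 0 ≤ C ∧ ∀ y, ‖h y‖ ≤ C :=
  ⟨‖(h : BoundedContinuousFunction X E)‖, norm_nonneg _,
    fun y => (h : BoundedContinuousFunction X E).norm_coe_le_norm y⟩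

/-- Makes a disjoint union of compact Hausdorff spaces normal, as the density of compactly supported
continuous functions in `L^p` requires. -/
instance paracompactSpace_of_discrete {X : Type*} [TopologicalSpace X] [DiscreteTopology X] :
    ParacompactSpace X where
  locallyFinite_refinement α s _ hu := by
    refine ⟨X, fun x => {x}, fun x => isOpen_discrete _, Set.iUnion_of_singleton X,
      fun x => ⟨{x}, (isOpen_discrete _).mem_nhds rfl, ?_⟩, fun x => ?_⟩
    · refine (Set.finite_singleton x).subset fun y hy => ?_
      obtain ⟨z, hz1, hz2⟩ := hy
      exact hz1.symm.trans hz2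
    · obtain ⟨a, ha⟩ := Set.iUnion_eq_univ_iff.1 hu x
      exact ⟨a, Set.singleton_subset_iff.2 ha⟩

variable [NormedRing E]

/-- The function `z ↦ ∑ a, h (a, z) * w a z` on `Z`, for a compactly supported continuous function
`h` on the disjoint union of copies of the Stone–Čech compactification of the discrete
space `Z`. The sum is finite. -/
def weightedTrace (w : A → Z → E) (h : C_c(A × Ultrafilter Z, E)) (z : Z) : E :=
  ∑ᶠ a, h (a, pure z) * w a z

theorem weightedTrace_eq_sum (w : A → Z → E) (h : C_c(A × Ultrafilter Z, E)) {F : Finset A}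
    (hF : ∀ a ∉ F, ∀ x, h (a, x) = 0) (z : Z) :
    weightedTrace w h z = ∑ a ∈ F, h (a, pure z) * w a z := by
  refine finsum_eq_sum_of_support_subset _ fun a ha => ?_
  by_contra hne
  exact ha (by simp only [hF a hne, zero_mul])

theorem weightedTrace_add [DiscreteTopology A] (w : A → Z → E) (h k : C_c(A × Ultrafilter Z, E))
    (z : Z) :
    weightedTrace w (h + k) z = weightedTrace w h z + weightedTrace w k z := by
  classical
  obtain ⟨F, hF⟩ := exists_finset_support h
  obtain ⟨G, hG⟩ := exists_finset_support k
  have hF' : ∀ a ∉ F ∪ G, ∀ x, h (a, x) = 0 := fun a ha =>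
    hF a fun h' => ha (Finset.mem_union_left _ h')
  have hG' : ∀ a ∉ F ∪ G, ∀ x, k (a, x) = 0 := fun a ha =>
    hG a fun h' => ha (Finset.mem_union_right _ h')
  rw [weightedTrace_eq_sum w h hF', weightedTrace_eq_sum w k hG',
    weightedTrace_eq_sum w (h + k) (F := F ∪ G) (fun a ha x => by
      rw [CompactlySupportedContinuousMap.add_apply, hF' a ha, hG' a ha, add_zero]),
    ← Finset.sum_add_distrib]
  exact Finset.sum_congr rfl fun a _ => by
    rw [CompactlySupportedContinuousMap.add_apply, add_mul]

theorem weightedTrace_smul [DiscreteTopology A] (w : A → Z → E) (c : E)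
    (h : C_c(A × Ultrafilter Z, E)) (z : Z) :
    weightedTrace w (c • h) z = c * weightedTrace w h z := by
  obtain ⟨F, hF⟩ := exists_finset_support h
  rw [weightedTrace_eq_sum w h hF, weightedTrace_eq_sum w (c • h) (F := F) (fun a ha x => by
      rw [CompactlySupportedContinuousMap.smul_apply, hF a ha, smul_zero]), Finset.mul_sum]
  exact Finset.sum_congr rfl fun a _ => by
    rw [CompactlySupportedContinuousMap.smul_apply, smul_eq_mul, mul_assoc]

end Pairing

variable {𝕜 : Type*} [RCLike 𝕜] {ι : Type*} {κ : ι → Type*} [∀ i, Fintype (κ i)]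
  {p : ℝ≥0∞} [Fact (1 ≤ p)] {U : Ultrafilter ι}
  {A : Type*} [TopologicalSpace A] [DiscreteTopology A] {e : A → (Σ i, κ i) → ℝ}

theorem exists_tendsto_of_bdd (U : Ultrafilter ι) {x : ι → ℝ} {C : ℝ} (hC : ∀ i, |x i| ≤ C) :
    ∃ l, Tendsto x U (𝓝 l) := by
  obtain ⟨l, -, hl⟩ := (isCompact_Icc (a := -C) (b := C)).ultrafilter_le_nhds (U.map x) (by
    rw [le_principal_iff]
    exact Filter.mem_map.2 (Filter.univ_mem' fun i => abs_le.1 (hC i)))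
  exact ⟨l, hl⟩

namespace AsympDisjoint

variable (he : AsympDisjoint 𝕜 p U e) (hp : p ≠ ∞)

include he hp

theorem exists_tendsto_trace (h : C_c(A × Ultrafilter (Σ i, κ i), ℝ)) :
    ∃ l, Tendsto (fun i => ∑ z, weightedTrace (fun a z => e a z ^ p.toReal) h ⟨i, z⟩) U (𝓝 l) := by
  obtain ⟨F, hF⟩ := exists_finset_support h
  obtain ⟨C, hC0, hC⟩ := exists_norm_le h
  choose B hB using fun a => he.bdd a
  refine exists_tendsto_of_bdd U (C := ∑ a ∈ F, C * B a ^ p.toReal) fun i => ?_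
  simp only [weightedTrace_eq_sum _ h hF]
  rw [Finset.sum_comm]
  refine (Finset.abs_sum_le_sum_abs _ _).trans (Finset.sum_le_sum fun a _ => ?_)
  have h1 : ∑ z, e a ⟨i, z⟩ ^ p.toReal ≤ B a ^ p.toReal := by
    have hq := one_le_toReal_of_fact hp
    have := Real.rpow_le_rpow (norm_nonneg _) (hB a i) (by linarith : 0 ≤ p.toReal)
    rw [PiLp.norm_rpow_toReal hp] at this
    refine (le_of_eq (Finset.sum_congr rfl fun z _ => ?_)).trans this
    change _ = ‖((e a ⟨i, z⟩ : ℝ) : 𝕜)‖ ^ _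
    rw [RCLike.norm_ofReal, abs_of_nonneg (he.nonneg a _)]
  refine (Finset.abs_sum_le_sum_abs _ _).trans ?_
  refine le_trans ?_ (mul_le_mul_of_nonneg_left h1 hC0)
  rw [Finset.mul_sum]
  refine Finset.sum_le_sum fun z _ => ?_
  have h2 : 0 ≤ e a ⟨i, z⟩ ^ p.toReal := Real.rpow_nonneg (he.nonneg a _) _
  rw [abs_mul, abs_of_nonneg h2]
  exact mul_le_mul_of_nonneg_right (hC _) h2

/-- The positive functional `h ↦ lim_U ∑ z, ∑ a, h (a, z) * e a z ^ p`. -/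
def functional : C_c(A × Ultrafilter (Σ i, κ i), ℝ) →ₚ[ℝ] ℝ :=
  PositiveLinearMap.mk₀
    { toFun := fun h => Classical.choose (he.exists_tendsto_trace hp h)
      map_add' := by
        intro h k
        refine tendsto_nhds_unique (Classical.choose_spec (he.exists_tendsto_trace hp (h + k))) ?_
        refine ((Classical.choose_spec (he.exists_tendsto_trace hp h)).add
          (Classical.choose_spec (he.exists_tendsto_trace hp k))).congr fun i => ?_
        rw [← Finset.sum_add_distrib]
        exact Finset.sum_congr rfl fun z _ => (weightedTrace_add _ _ _ _).symm
      map_smul' := by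
        intro c h
        refine tendsto_nhds_unique (Classical.choose_spec (he.exists_tendsto_trace hp (c • h))) ?_
        refine ((Classical.choose_spec (he.exists_tendsto_trace hp h)).const_mul c).congr
          fun i => ?_
        rw [Finset.mul_sum]
        exact Finset.sum_congr rfl fun z _ => (weightedTrace_smul _ _ _ _).symm }
    (by
      intro h hh
      refine ge_of_tendsto' (Classical.choose_spec (he.exists_tendsto_trace hp h)) fun i =>
        Finset.sum_nonneg fun z _ => finsum_nonneg fun a => ?_
      exact mul_nonneg (hh _) (Real.rpow_nonneg (he.nonneg a _) _))

theorem tendsto_functional (h : C_c(A × Ultrafilter (Σ i, κ i), ℝ)) :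
    Tendsto (fun i => ∑ z, weightedTrace (fun a z => e a z ^ p.toReal) h ⟨i, z⟩) U
      (𝓝 (he.functional hp h)) :=
  Classical.choose_spec (he.exists_tendsto_trace hp h)

theorem weightedTrace_bdd (h : C_c(A × Ultrafilter (Σ i, κ i), 𝕜)) :
    SliceBdd p (weightedTrace (fun a z => (e a z : 𝕜)) h) := by
  obtain ⟨F, hF⟩ := exists_finset_support h
  obtain ⟨C, -, hC⟩ := exists_norm_le h
  have : weightedTrace (fun a z => (e a z : 𝕜)) h
      = fun z => ∑ a ∈ F, h (a, pure z) * (e a z : 𝕜) :=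
    funext fun z => weightedTrace_eq_sum _ h hF z
  rw [this]
  exact SliceBdd.sum F (g := fun a z => h (a, pure z) * (e a z : 𝕜))
    fun a _ => he.bdd_mul hp a fun z => hC _

/-- The functional computes the norm of the represented element of the ultraproduct. -/
theorem functional_norm_rpow (h : C_c(A × Ultrafilter (Σ i, κ i), 𝕜))
    (k : C_c(A × Ultrafilter (Σ i, κ i), ℝ)) (hk : ∀ y, k y = ‖h y‖ ^ p.toReal) :
    he.functional hp k
      = ‖cls p U (weightedTrace (fun a z => (e a z : 𝕜)) h)‖ ^ p.toReal := by
  obtain ⟨F, hF⟩ := exists_finset_support h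
  obtain ⟨C, -, hC⟩ := exists_norm_le h
  have hq := one_le_toReal_of_fact hp
  have hFk : ∀ a ∉ F, ∀ x, k (a, x) = 0 := fun a ha x => by
    rw [hk, hF a ha, norm_zero, Real.zero_rpow (by linarith)]
  have h0 : weightedTrace (fun a z => (e a z : 𝕜)) h
      = fun z => ∑ a ∈ F, h (a, pure z) * (e a z : 𝕜) :=
    funext fun z => weightedTrace_eq_sum _ h hF z
  rw [h0, he.norm_cls_sum_rpow hp F (h := fun a z => h (a, pure z)) fun a z => hC _]
  have h1 := he.tendsto_functional hp k
  have h1a := fun a => tendsto_sum_norm_rpow U hp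
    (he.bdd_mul hp a (h := fun z => h (a, pure z)) fun z => hC _)
  have h2 := tendsto_finsetSum F fun a _ => h1a a
  refine tendsto_nhds_unique h1 (h2.congr fun i => ?_)
  rw [Finset.sum_comm]
  refine Finset.sum_congr rfl fun z _ => ?_
  rw [weightedTrace_eq_sum _ k hFk]
  refine Finset.sum_congr rfl fun a _ => ?_
  rw [norm_mul, hk, RCLike.norm_ofReal, abs_of_nonneg (he.nonneg a _),
    Real.mul_rpow (norm_nonneg _) (he.nonneg a _)]

variable [MeasurableSpace (A × Ultrafilter (Σ i, κ i))]
  [BorelSpace (A × Ultrafilter (Σ i, κ i))]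

/-- The Radon measure of the functional. -/
def measure : Measure (A × Ultrafilter (Σ i, κ i)) := RealRMK.rieszMeasure (he.functional hp)

instance regular_measure : (he.measure hp).Regular := RealRMK.regular_rieszMeasure _

theorem memLp_cc (h : C_c(A × Ultrafilter (Σ i, κ i), 𝕜)) : MemLp h p (he.measure hp) :=
  h.continuous.memLp_of_hasCompactSupport h.hasCompactSupport

/-- The inclusion of the compactly supported continuous functions in `L^p`. -/
def ccToLp : C_c(A × Ultrafilter (Σ i, κ i), 𝕜) →ₗ[𝕜] Lp 𝕜 p (he.measure hp) where
  toFun h := (he.memLp_cc hp h).toLp h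
  map_add' _ _ := rfl
  map_smul' _ _ := rfl

theorem norm_ccToLp_rpow (h : C_c(A × Ultrafilter (Σ i, κ i), 𝕜)) :
    ‖he.ccToLp hp h‖ ^ p.toReal
      = ‖cls p U (weightedTrace (fun a z => (e a z : 𝕜)) h)‖ ^ p.toReal := by
  have hq := one_le_toReal_of_fact hp
  have hp0 : p ≠ 0 := (zero_lt_one.trans_le (Fact.out : 1 ≤ p)).ne'
  let φ : C(𝕜, ℝ) := ⟨fun x => ‖x‖ ^ p.toReal,
    continuous_norm.rpow_const fun _ => Or.inr (by linarith)⟩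
  have hφ : φ 0 = 0 := by
    change ‖(0 : 𝕜)‖ ^ p.toReal = 0
    rw [norm_zero, Real.zero_rpow (by linarith)]
  have hk : ∀ y, h.compLeft φ y = ‖h y‖ ^ p.toReal := fun y =>
    CompactlySupportedContinuousMap.compLeft_apply hφ h y
  rw [← he.functional_norm_rpow hp h (h.compLeft φ) hk,
    ← RealRMK.integral_rieszMeasure (he.functional hp) (h.compLeft φ)]
  change ‖(he.memLp_cc hp h).toLp h‖ ^ p.toReal = _
  rw [Lp.norm_toLp, (he.memLp_cc hp h).eLpNorm_eq_integral_rpow_norm hp0 hp,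
    ENNReal.toReal_ofReal (by positivity), ← Real.rpow_mul (integral_nonneg fun y => by positivity),
    inv_mul_cancel₀ (by linarith), Real.rpow_one]
  exact integral_congr_ae (Eventually.of_forall fun y => (hk y).symm)

theorem norm_ccToLp (h : C_c(A × Ultrafilter (Σ i, κ i), 𝕜)) :
    ‖he.ccToLp hp h‖ = ‖cls p U (weightedTrace (fun a z => (e a z : 𝕜)) h)‖ := by
  have hq := one_le_toReal_of_fact hp
  exact (Real.rpow_left_inj (norm_nonneg _) (norm_nonneg _) (by linarith)).1
    (he.norm_ccToLp_rpow hp h)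

theorem denseRange_ccToLp : DenseRange (he.ccToLp hp) := by
  intro f
  rw [Metric.mem_closure_iff]
  intro ε hε
  obtain ⟨g, hgs, hg, hgc, hgm⟩ := (Lp.memLp f).exists_hasCompactSupport_eLpNorm_sub_le hp
    (ε := ENNReal.ofReal (ε / 2)) (by simpa using hε)
  let h : C_c(A × Ultrafilter (Σ i, κ i), 𝕜) := ⟨⟨g, hgc⟩, hgs⟩
  refine ⟨_, ⟨h, rfl⟩, ?_⟩
  rw [dist_eq_norm]
  have h1 : f - he.ccToLp hp h = ((Lp.memLp f).sub (he.memLp_cc hp h)).toLp (⇑f - ⇑h) := by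
    rw [MemLp.toLp_sub (Lp.memLp f) (he.memLp_cc hp h), Lp.toLp_coeFn]
    rfl
  rw [h1, Lp.norm_toLp]
  refine (ENNReal.toReal_mono ENNReal.ofReal_ne_top hg).trans_lt ?_
  rw [ENNReal.toReal_ofReal (by linarith)]
  linarith

/-- The linear map sending a compactly supported continuous function to the element
`∑ a, h (a, ·) e a` of the ultraproduct. -/
def ccToUltra : C_c(A × Ultrafilter (Σ i, κ i), 𝕜) →ₗ[𝕜] UltraLp 𝕜 U κ p where
  toFun h := cls p U (weightedTrace (fun a z => (e a z : 𝕜)) h)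
  map_add' h k := by
    rw [← cls_add U (he.weightedTrace_bdd hp h) (he.weightedTrace_bdd hp k)]
    exact congrArg _ (funext fun z => weightedTrace_add _ _ _ _)
  map_smul' c h := by
    rw [RingHom.id_apply, ← cls_const_mul U (he.weightedTrace_bdd hp h)]
    exact congrArg _ (funext fun z => weightedTrace_smul _ _ _ _)

/-- The isometric embedding of `L^p` into the ultraproduct. -/
def lpToUltra : Lp 𝕜 p (he.measure hp) →ₗᵢ[𝕜] UltraLp 𝕜 U κ p where
  toLinearMap := ((he.ccToUltra hp).extendOfNorm (he.ccToLp hp)).toLinearMap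
  norm_map' := by
    intro f
    refine (he.denseRange_ccToLp hp).induction_on (p := fun f =>
      ‖((he.ccToUltra hp).extendOfNorm (he.ccToLp hp)) f‖ = ‖f‖) f ?_ fun h => ?_
    · exact isClosed_eq (ContinuousLinearMap.continuous _).norm continuous_norm
    · rw [LinearMap.extendOfNorm_eq (he.denseRange_ccToLp hp)
        ⟨1, fun h => by rw [one_mul, he.norm_ccToLp hp]; rfl⟩, he.norm_ccToLp hp]
      rfl

theorem lpToUltra_cc (h : C_c(A × Ultrafilter (Σ i, κ i), 𝕜)) :
    he.lpToUltra hp (he.ccToLp hp h) = cls p U (weightedTrace (fun a z => (e a z : 𝕜)) h) :=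
  LinearMap.extendOfNorm_eq (he.denseRange_ccToLp hp)
        ⟨1, fun h => by rw [one_mul, he.norm_ccToLp hp]; rfl⟩ h

end AsympDisjoint

end Representation

/-! ### Surjectivity of the representation -/

noncomputable section Surjectivity

open Filter Topology CompactlySupported

/-- A bounded scalar function on a discrete space extends continuously to its Stone–Čech
compactification. -/
theorem exists_continuous_extension {𝕜 Z : Type*} [RCLike 𝕜] {h : Z → 𝕜} {C : ℝ}
    (hC : ∀ z, ‖h z‖ ≤ C) : ∃ H : Ultrafilter Z → 𝕜, Continuous H ∧ ∀ z, H (pure z) = h z := by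
  have : CompactSpace (Metric.closedBall (0 : 𝕜) C) :=
    isCompact_iff_compactSpace.1 (isCompact_closedBall 0 C)
  let f : Z → Metric.closedBall (0 : 𝕜) C := fun z => ⟨h z, by simpa using hC z⟩
  refine ⟨fun x => ((Ultrafilter.extend f x : Metric.closedBall (0 : 𝕜) C) : 𝕜),
    continuous_subtype_val.comp (continuous_ultrafilter_extend f), fun z => ?_⟩
  simp only [ultrafilter_extend_pure, f]

variable {𝕜 : Type*} [RCLike 𝕜] {ι : Type*} {κ : ι → Type*} [∀ i, Fintype (κ i)]
  {p : ℝ≥0∞} [Fact (1 ≤ p)] {U : Ultrafilter ι}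
  {A : Type*} [TopologicalSpace A] [DiscreteTopology A] {e : A → (Σ i, κ i) → ℝ}

theorem SliceBdd.of_le_ofReal (hp : p ≠ ∞) {g h : (Σ i, κ i) → ℝ}
    (hh : SliceBdd p (fun z => (h z : 𝕜))) (hg0 : ∀ z, 0 ≤ g z) (hgh : ∀ z, g z ≤ h z) :
    SliceBdd p (fun z => (g z : 𝕜)) := by
  refine hh.mono hp fun z => ?_
  rw [RCLike.norm_ofReal, RCLike.norm_ofReal, abs_of_nonneg (hg0 z)]
  exact (hgh z).trans (le_abs_self _)

namespace AsympDisjoint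

variable [MeasurableSpace (A × Ultrafilter (Σ i, κ i))]
  [BorelSpace (A × Ultrafilter (Σ i, κ i))]
  (he : AsympDisjoint 𝕜 p U e) (hp : p ≠ ∞)

include he hp

/-- The range of the embedding of `L^p` into the ultraproduct. -/
def lpRange : Submodule 𝕜 (UltraLp 𝕜 U κ p) := LinearMap.range (he.lpToUltra hp).toLinearMap

theorem isClosed_lpRange : IsClosed (he.lpRange hp : Set (UltraLp 𝕜 U κ p)) := by
  have := (he.lpToUltra hp).isometry.isUniformInducing.isComplete_range.isClosed
  exact this

theorem bdd_mul_mem_lpRange (a : A) {h : (Σ i, κ i) → 𝕜} {C : ℝ} (hC : ∀ z, ‖h z‖ ≤ C) :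
    cls p U (fun z => h z * (e a z : 𝕜)) ∈ he.lpRange hp := by
  classical
  obtain ⟨H, hH, hHh⟩ := exists_continuous_extension hC
  let χ : A → 𝕜 := fun b => if b = a then 1 else 0
  have hχ : Continuous χ := continuous_of_discreteTopology
  let f : A × Ultrafilter (Σ i, κ i) → 𝕜 := fun y => χ y.1 * H y.2
  have hf : Continuous f := (hχ.comp continuous_fst).mul (hH.comp continuous_snd)
  have hfs : HasCompactSupport f := by
    refine HasCompactSupport.intro (isCompact_singleton.prod isCompact_univ :
      IsCompact ({a} ×ˢ (Set.univ : Set (Ultrafilter (Σ i, κ i))))) fun y hy => ?_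
    have : y.1 ≠ a := fun h => hy ⟨h, Set.mem_univ _⟩
    simp [f, χ, this]
  let k : C_c(A × Ultrafilter (Σ i, κ i), 𝕜) := ⟨⟨f, hf⟩, hfs⟩
  refine ⟨he.ccToLp hp k, ?_⟩
  refine (he.lpToUltra_cc hp k).trans (congrArg _ (funext fun z => ?_))
  rw [weightedTrace_eq_sum _ k (F := {a}) (fun b hb x => ?_), Finset.sum_singleton]
  · change χ a * H (pure z) * _ = _
    simp [χ, hHh]
  · have : b ≠ a := fun h => hb (Finset.mem_singleton.2 h)
    change χ b * H x = 0
    simp [χ, this]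

theorem bdd_mul_cc_mem_lpRange (h : C_c(A × Ultrafilter (Σ i, κ i), 𝕜)) {b : (Σ i, κ i) → 𝕜}
    {C : ℝ} (hb : ∀ z, ‖b z‖ ≤ C) :
    cls p U (fun z => b z * weightedTrace (fun a z => (e a z : 𝕜)) h z) ∈ he.lpRange hp := by
  obtain ⟨F, hF⟩ := exists_finset_support h
  obtain ⟨B, hB0, hB⟩ := exists_norm_le h
  have h1 : ∀ a z, ‖b z * h (a, pure z)‖ ≤ C * B := fun a z => by
    rw [norm_mul]
    exact mul_le_mul (hb z) (hB _) (norm_nonneg _) ((norm_nonneg _).trans (hb z))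
  have h2 : (fun z => b z * weightedTrace (fun a z => (e a z : 𝕜)) h z)
      = fun z => ∑ a ∈ F, (b z * h (a, pure z)) * (e a z : 𝕜) := by
    funext z
    rw [weightedTrace_eq_sum _ h hF, Finset.mul_sum]
    exact Finset.sum_congr rfl fun a _ => (mul_assoc _ _ _).symm
  rw [h2, cls_sum U F (g := fun a z => (b z * h (a, pure z)) * (e a z : 𝕜))
    fun a _ => he.bdd_mul hp a (h1 a)]
  exact Submodule.sum_mem _ fun a _ => he.bdd_mul_mem_lpRange hp a (h1 a)

theorem exists_cc_norm_sub_lt (f : Lp 𝕜 p (he.measure hp)) {ε : ℝ} (hε : 0 < ε) :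
    ∃ h : C_c(A × Ultrafilter (Σ i, κ i), 𝕜), ‖f - he.ccToLp hp h‖ < ε := by
  obtain ⟨_, ⟨h, rfl⟩, hlt⟩ := Metric.mem_closure_iff.1 (he.denseRange_ccToLp hp f) ε hε
  exact ⟨h, by rwa [← dist_eq_norm]⟩

/-- The range is stable under multiplication by bounded functions. -/
theorem bdd_mul_mem_lpRange_of_mem {g b : (Σ i, κ i) → 𝕜} (hg : SliceBdd p g)
    (hmem : cls p U g ∈ he.lpRange hp) {C : ℝ} (hb : ∀ z, ‖b z‖ ≤ C) :
    cls p U (fun z => b z * g z) ∈ he.lpRange hp := by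
  have hb' : ∀ z, ‖b z‖ ≤ |C| + 1 := fun z => (hb z).trans (by linarith [le_abs_self C])
  have hC0 : 0 < |C| + 1 := by positivity
  obtain ⟨f, hf⟩ := hmem
  have hf : he.lpToUltra hp f = cls p U g := hf
  rw [← SetLike.mem_coe, ← (he.isClosed_lpRange hp).closure_eq, Metric.mem_closure_iff]
  intro ε hε
  obtain ⟨h, hlt⟩ := he.exists_cc_norm_sub_lt hp f (div_pos hε hC0)
  have hhb := he.weightedTrace_bdd hp h
  refine ⟨_, he.bdd_mul_cc_mem_lpRange hp h hb', ?_⟩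
  have h1 : cls p U (fun z => b z * g z)
      - cls p U (fun z => b z * weightedTrace (fun a z => (e a z : 𝕜)) h z)
      = cls p U (fun z => b z * (g z - weightedTrace (fun a z => (e a z : 𝕜)) h z)) := by
    rw [← cls_sub U (hg.bdd_mul hp hb') (hhb.bdd_mul hp hb')]
    simp only [mul_sub]
  rw [dist_eq_norm, h1]
  refine (norm_cls_bdd_mul_le U hp (hg.sub hhb) hC0.le hb').trans_lt ?_
  rw [cls_sub U hg hhb, ← hf, ← he.lpToUltra_cc hp h, ← map_sub, LinearIsometry.norm_map]
  rwa [lt_div_iff₀' hC0] at hlt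

/-- The part of a nonnegative element `γ` in the range. Among the functions between `0` and `γ`
whose class lies in the range there is one of maximal norm: a maximising sequence may be taken
increasing, and it is then a Cauchy sequence because the `p`-th power of the norm is
superadditive. -/
theorem exists_max_part {γ : (Σ i, κ i) → ℝ} (hγ0 : ∀ z, 0 ≤ γ z)
    (hγ : SliceBdd p (fun z => (γ z : 𝕜))) :
    ∃ g : (Σ i, κ i) → ℝ, (∀ z, 0 ≤ g z) ∧ (∀ z, g z ≤ γ z) ∧
      cls p U (fun z => (g z : 𝕜)) ∈ he.lpRange hp ∧
      ∀ g' : (Σ i, κ i) → ℝ, (∀ z, 0 ≤ g' z) → (∀ z, g' z ≤ γ z) →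
        cls p U (fun z => (g' z : 𝕜)) ∈ he.lpRange hp →
        ‖cls p U (fun z => (g' z : 𝕜))‖ ≤ ‖cls p U (fun z => (g z : 𝕜))‖ := by
  have hq := one_le_toReal_of_fact hp
  let S : Set ((Σ i, κ i) → ℝ) := {g | (∀ z, 0 ≤ g z) ∧ (∀ z, g z ≤ γ z) ∧
    cls p U (fun z => (g z : 𝕜)) ∈ he.lpRange hp}
  have hSb : ∀ g ∈ S, SliceBdd p (fun z => (g z : 𝕜)) := fun g hg =>
    hγ.of_le_ofReal hp hg.1 hg.2.1
  let N : ((Σ i, κ i) → ℝ) → ℝ := fun g => ‖cls p U (fun z => (g z : 𝕜))‖ ^ p.toReal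
  have hmono : ∀ g g' : (Σ i, κ i) → ℝ, (∀ z, 0 ≤ g z) → (∀ z, g z ≤ g' z) →
      SliceBdd p (fun z => (g' z : 𝕜)) → N g ≤ N g' := fun g g' h0 h1 hb =>
    Real.rpow_le_rpow (norm_nonneg _) (norm_cls_le U hp hb fun z => by
      rw [RCLike.norm_ofReal, RCLike.norm_ofReal, abs_of_nonneg (h0 z)]
      exact (h1 z).trans (le_abs_self _)) (by linarith)
  have hbdd : BddAbove (N '' S) := ⟨N γ, by
    rintro _ ⟨g, hg, rfl⟩
    exact hmono g γ hg.1 hg.2.1 hγ⟩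
  have hS0 : (fun _ => 0 : (Σ i, κ i) → ℝ) ∈ S := by
    refine ⟨fun _ => le_rfl, hγ0, ?_⟩
    simp only [RCLike.ofReal_zero, cls_zero]
    exact Submodule.zero_mem _
  have hmax : ∀ g ∈ S, ∀ g' ∈ S, (fun z => max (g z) (g' z)) ∈ S := by
    intro g hg g' hg'
    refine ⟨fun z => le_max_of_le_left (hg.1 z), fun z => max_le (hg.2.1 z) (hg'.2.1 z), ?_⟩
    have hsum : cls p U (fun z => (g z : 𝕜) + (g' z : 𝕜)) ∈ he.lpRange hp := by
      rw [cls_add U (hSb g hg) (hSb g' hg')]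
      exact Submodule.add_mem _ hg.2.2 hg'.2.2
    have hle : ∀ z, max (g z) (g' z) ≤ g z + g' z := fun z =>
      max_le (by linarith [hg'.1 z]) (by linarith [hg.1 z])
    have h := he.bdd_mul_mem_lpRange_of_mem hp ((hSb g hg).add (hSb g' hg')) hsum
      (b := fun z => ((max (g z) (g' z) / (g z + g' z) : ℝ) : 𝕜)) (C := 1) (fun z => by
        have h0 : 0 ≤ max (g z) (g' z) := le_max_of_le_left (hg.1 z)
        rw [RCLike.norm_ofReal, abs_of_nonneg (div_nonneg h0 (add_nonneg (hg.1 z) (hg'.1 z)))]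
        exact div_le_one_of_le₀ (hle z) (add_nonneg (hg.1 z) (hg'.1 z)))
    convert h using 3 with z
    rw [← RCLike.ofReal_add, ← RCLike.ofReal_mul]
    by_cases h0 : g z + g' z = 0
    · have : max (g z) (g' z) = 0 :=
        le_antisymm (h0 ▸ hle z) (le_max_of_le_left (hg.1 z))
      simp [this, h0]
    · rw [div_mul_cancel₀ _ h0]
  have hne : (N '' S).Nonempty := ⟨_, Set.mem_image_of_mem N hS0⟩
  set s := sSup (N '' S) with hs
  have hlub : IsLUB (N '' S) s := isLUB_csSup hne hbdd
  have hseq : ∀ n : ℕ, ∃ g ∈ S, s - 1 / ((n : ℝ) + 1) < N g := by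
    intro n
    obtain ⟨_, ⟨g, hg, rfl⟩, hlt⟩ := exists_lt_of_lt_csSup hne
      (sub_lt_self s (by positivity : (0 : ℝ) < 1 / (n + 1)))
    exact ⟨g, hg, hlt⟩
  choose c hcS hcN using hseq
  obtain ⟨d, hd0, hd⟩ : ∃ d : ℕ → (Σ i, κ i) → ℝ, d 0 = c 0 ∧
      ∀ n, d (n + 1) = fun z => max (d n z) (c (n + 1) z) :=
    ⟨fun n => Nat.rec (c 0) (fun n g z => max (g z) (c (n + 1) z)) n, rfl, fun _ => rfl⟩
  have hdS : ∀ n, d n ∈ S := by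
    intro n
    induction n with
    | zero => exact hd0 ▸ hcS 0
    | succ n ih => exact hd n ▸ hmax _ ih _ (hcS (n + 1))
  have hcd : ∀ n z, c n z ≤ d n z := by
    intro n z
    cases n with
    | zero => rw [hd0]
    | succ n => rw [hd]; exact le_max_right _ _
  have hdmono : ∀ z, Monotone fun n => d n z := fun z =>
    monotone_nat_of_le_succ fun n => by rw [hd]; exact le_max_left _ _
  have hdN : ∀ n : ℕ, s - 1 / ((n : ℝ) + 1) < N (d n) := fun n =>
    (hcN n).trans_le (hmono _ _ (hcS n).1 (hcd n) (hSb _ (hdS n)))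
  have hNd : ∀ n, N (d n) ≤ s := fun n => hlub.1 (Set.mem_image_of_mem N (hdS n))
  let X : ℕ → UltraLp 𝕜 U κ p := fun n => cls p U (fun z => (d n z : 𝕜))
  have hdist : ∀ n m : ℕ, n ≤ m → ‖X m - X n‖ ^ p.toReal
        ≤ 1 / ((n : ℝ) + 1) := by
    intro n m hnm
    have hle : ∀ z, d n z ≤ d m z := fun z => hdmono z hnm
    have hb : SliceBdd p (fun z => ((d m z - d n z : ℝ) : 𝕜)) :=
      (hSb _ (hdS m)).of_le_ofReal hp (fun z => sub_nonneg.2 (hle z))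
        fun z => sub_le_self _ ((hdS n).1 z)
    have h1 := norm_cls_add_rpow_le U hp hb (hSb _ (hdS n)) (fun z => sub_nonneg.2 (hle z))
      (hdS n).1
    have h2 : (fun z => ((d m z - d n z : ℝ) : 𝕜) + (d n z : 𝕜)) = fun z => (d m z : 𝕜) := by
      funext z
      rw [← RCLike.ofReal_add, sub_add_cancel]
    have h3 : X m - X n
        = cls p U (fun z => ((d m z - d n z : ℝ) : 𝕜)) := by
      refine (cls_sub U (hSb _ (hdS m)) (hSb _ (hdS n))).symm.trans ?_
      simp only [RCLike.ofReal_sub]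
    rw [h2] at h1
    rw [h3]
    have h4 := hdN n
    have h5 := hNd m
    simp only [N] at h4 h5
    linarith
  have hcauchy : CauchySeq X := by
    have hlim : Tendsto (fun n : ℕ => (1 / ((n : ℝ) + 1)) ^ (1 / p.toReal)) atTop (𝓝 0) := by
      have h1 := (tendsto_one_div_add_atTop_nhds_zero_nat (𝕜 := ℝ)).rpow_const
        (p := 1 / p.toReal) (Or.inr (by positivity))
      rwa [Real.zero_rpow (by positivity)] at h1
    refine cauchySeq_of_le_tendsto_0' _ (fun n m hnm => ?_) hlim
    rw [dist_comm, dist_eq_norm]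
    have h1 := Real.rpow_le_rpow (by positivity) (hdist n m hnm)
      (by positivity : 0 ≤ 1 / p.toReal)
    rwa [← Real.rpow_mul (norm_nonneg _), mul_one_div_cancel (by linarith), Real.rpow_one] at h1
  obtain ⟨x, hx⟩ := cauchySeq_tendsto_of_complete hcauchy
  have hxmem : x ∈ he.lpRange hp :=
    (he.isClosed_lpRange hp).mem_of_tendsto hx (Eventually.of_forall fun n => (hdS n).2.2)
  obtain ⟨k, hk, rfl⟩ := exists_cls_eq U x
  -- A representative of the limit may be clamped to the interval `[0, γ]`.
  let g : (Σ i, κ i) → ℝ := fun z => max 0 (min (RCLike.re (k z)) (γ z))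
  have hg0 : ∀ z, 0 ≤ g z := fun z => le_max_left _ _
  have hgγ : ∀ z, g z ≤ γ z := fun z => max_le (hγ0 z) (min_le_right _ _)
  have hgb : SliceBdd p (fun z => (g z : 𝕜)) := hγ.of_le_ofReal hp hg0 hgγ
  have hclamp : ∀ n, ‖X n - cls p U (fun z => (g z : 𝕜))‖ ≤ ‖X n - cls p U k‖ := by
    intro n
    simp only [X]
    rw [← cls_sub U (hSb _ (hdS n)) hgb, ← cls_sub U (hSb _ (hdS n)) hk]
    refine norm_cls_le U hp ((hSb _ (hdS n)).sub hk) fun z => ?_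
    have h1 : d n z = max 0 (min (d n z) (γ z)) := by
      rw [min_eq_left ((hdS n).2.1 z), max_eq_right ((hdS n).1 z)]
    have h2 : |d n z - g z| ≤ |d n z - RCLike.re (k z)| := by
      conv_lhs => rw [h1]
      refine (abs_max_sub_max_le_max _ _ _ _).trans (max_le (by simp) ?_)
      refine (abs_min_sub_min_le_max _ _ _ _).trans (max_le le_rfl (by simp))
    rw [← RCLike.ofReal_sub, RCLike.norm_ofReal]
    refine h2.trans ?_
    have h3 : d n z - RCLike.re (k z) = RCLike.re ((d n z : 𝕜) - k z) := by simp
    rw [h3]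
    exact RCLike.abs_re_le_norm _
  have hgk : cls p U (fun z => (g z : 𝕜)) = cls p U k := by
    refine tendsto_nhds_unique ?_ hx
    rw [tendsto_iff_norm_sub_tendsto_zero] at hx ⊢
    exact squeeze_zero (fun n => norm_nonneg _) hclamp hx
  refine ⟨g, hg0, hgγ, hgk ▸ hxmem, fun g' h1 h2 h3 => ?_⟩
  have hNg : s ≤ N g := by
    have hlim : Tendsto (fun n => N (d n)) atTop (𝓝 (N g)) := by
      simp only [N, hgk]
      exact hx.norm.rpow_const (Or.inr (by linarith))
    have hlow : Tendsto (fun n : ℕ => s - 1 / ((n : ℝ) + 1)) atTop (𝓝 s) := by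
      simpa using tendsto_const_nhds.sub (tendsto_one_div_add_atTop_nhds_zero_nat (𝕜 := ℝ))
    exact le_of_tendsto_of_tendsto' hlow hlim fun n => (hdN n).le
  have hN : N g' ≤ N g := (hlub.1 ⟨g', ⟨h1, h2, h3⟩, rfl⟩).trans hNg
  exact (Real.rpow_le_rpow_iff (norm_nonneg _) (norm_nonneg _) (by linarith)).1 hN

/-- If the family is maximal, the representation is surjective: the part of a nonnegative element
outside the range is disjoint from the family. -/
theorem lpToUltra_surjective
    (hmaxl : ∀ r : (Σ i, κ i) → ℝ, (∀ z, 0 ≤ r z) → SliceBdd p (fun z => (r z : 𝕜)) →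
        (∀ a, cls p U (fun z => ((min (r z) (e a z) : ℝ) : 𝕜)) = 0) →
        cls p U (fun z => (r z : 𝕜)) = 0) :
    Function.Surjective (he.lpToUltra hp) := by
  have hq := one_le_toReal_of_fact hp
  intro x
  obtain ⟨k, hk, rfl⟩ := exists_cls_eq U x
  change cls p U k ∈ he.lpRange hp
  have hγ : SliceBdd p (fun z => ((‖k z‖ : ℝ) : 𝕜)) := hk.mono hp fun z => by simp
  obtain ⟨g, hg0, hgγ, hgmem, hgmax⟩ := he.exists_max_part hp (γ := fun z => ‖k z‖)
    (fun z => norm_nonneg _) hγ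
  have hgb : SliceBdd p (fun z => (g z : 𝕜)) := hγ.of_le_ofReal hp hg0 hgγ
  let r : (Σ i, κ i) → ℝ := fun z => ‖k z‖ - g z
  have hr0 : ∀ z, 0 ≤ r z := fun z => sub_nonneg.2 (hgγ z)
  have hrb : SliceBdd p (fun z => (r z : 𝕜)) :=
    hγ.of_le_ofReal hp hr0 fun z => sub_le_self _ (hg0 z)
  have hr : cls p U (fun z => (r z : 𝕜)) = 0 := by
    refine hmaxl r hr0 hrb fun a => ?_
    let m : (Σ i, κ i) → ℝ := fun z => min (r z) (e a z)
    have hm0 : ∀ z, 0 ≤ m z := fun z => le_min (hr0 z) (he.nonneg a z)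
    have hmb : SliceBdd p (fun z => (m z : 𝕜)) := hrb.of_le_ofReal hp hm0 fun z => min_le_left _ _
    have hmmem : cls p U (fun z => (m z : 𝕜)) ∈ he.lpRange hp := by
      have h := he.bdd_mul_mem_lpRange hp a (h := fun z => ((m z / e a z : ℝ) : 𝕜)) (C := 1)
        fun z => by
          rw [RCLike.norm_ofReal, abs_of_nonneg (div_nonneg (hm0 z) (he.nonneg a z))]
          exact div_le_one_of_le₀ (min_le_right _ _) (he.nonneg a z)
      convert h using 3 with z
      rw [← RCLike.ofReal_mul]
      by_cases h0 : e a z = 0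
      · have : m z = 0 := le_antisymm (h0 ▸ min_le_right _ _) (hm0 z)
        simp [this, h0]
      · rw [div_mul_cancel₀ _ h0]
    have h1 := norm_cls_add_rpow_le U hp hgb hmb hg0 hm0
    have h2 := hgmax (fun z => g z + m z) (fun z => add_nonneg (hg0 z) (hm0 z))
      (fun z => by
        have : m z ≤ r z := min_le_left _ _
        simp only [r] at this
        linarith)
      (by
        simp only [RCLike.ofReal_add]
        rw [cls_add U hgb hmb]
        exact Submodule.add_mem _ hgmem hmmem)
    simp only [RCLike.ofReal_add] at h2
    have h3 := Real.rpow_le_rpow (norm_nonneg _) h2 (by linarith : 0 ≤ p.toReal)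
    have h4 : ‖cls p U (fun z => (m z : 𝕜))‖ ^ p.toReal = 0 :=
      le_antisymm (by linarith) (Real.rpow_nonneg (norm_nonneg _) _)
    exact norm_eq_zero.1 ((Real.rpow_eq_zero (norm_nonneg _) (by linarith)).1 h4)
  have habs : cls p U (fun z => ((‖k z‖ : ℝ) : 𝕜)) ∈ he.lpRange hp := by
    have : (fun z => ((‖k z‖ : ℝ) : 𝕜)) = fun z => (g z : 𝕜) + (r z : 𝕜) := by
      funext z
      rw [← RCLike.ofReal_add]
      simp [r]
    rw [this, cls_add U hgb hrb, hr, add_zero]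
    exact hgmem
  have h := he.bdd_mul_mem_lpRange_of_mem hp hγ habs (b := fun z => k z / ((‖k z‖ : ℝ) : 𝕜))
    (C := 1) fun z => by
      rw [norm_div, RCLike.norm_ofReal, abs_norm]
      exact div_self_le_one _
  convert h using 2
  funext z
  by_cases h0 : k z = 0
  · simp [h0]
  · rw [div_mul_cancel₀]
    simpa using h0

end AsympDisjoint

end Surjectivity

/-! ### Positivity of the representation -/

noncomputable section Positivity

open Filter Topology CompactlySupported

variable {𝕜 : Type*} [RCLike 𝕜]

/-- The positive part of the real part of a scalar. -/
def rePosPart (x : 𝕜) : 𝕜 := ((max (RCLike.re x) 0 : ℝ) : 𝕜)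

theorem rePosPart_zero : rePosPart (0 : 𝕜) = 0 := by simp [rePosPart]

theorem norm_rePosPart_sub_le (x y : 𝕜) : ‖rePosPart x - rePosPart y‖ ≤ ‖x - y‖ := by
  rw [rePosPart, rePosPart, ← RCLike.ofReal_sub, RCLike.norm_ofReal]
  refine (abs_max_sub_max_le_max _ _ _ _).trans (max_le ?_ (by simp))
  rw [← map_sub]
  exact RCLike.abs_re_le_norm _

theorem lipschitzWith_rePosPart : LipschitzWith 1 (rePosPart : 𝕜 → 𝕜) :=
  LipschitzWith.of_dist_le_mul fun x y => by
    rw [NNReal.coe_one, one_mul, dist_eq_norm, dist_eq_norm]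
    exact norm_rePosPart_sub_le x y

theorem rePosPart_eq_self_iff {x : 𝕜} : rePosPart x = x ↔ 0 ≤ RCLike.re x ∧ RCLike.im x = 0 := by
  rw [rePosPart, RCLike.ext_iff]
  simp only [RCLike.ofReal_re, RCLike.ofReal_im, max_eq_left_iff]
  exact and_congr_right fun _ => eq_comm

theorem rePosPart_mul_ofReal (x : 𝕜) {c : ℝ} (hc : 0 ≤ c) :
    rePosPart (x * (c : 𝕜)) = rePosPart x * (c : 𝕜) := by
  rw [rePosPart, rePosPart, mul_comm x, RCLike.re_ofReal_mul, ← RCLike.ofReal_mul, mul_comm c,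
    max_mul_of_nonneg _ _ hc, zero_mul]

theorem lpNonneg_iff_compLp_eq {Ω : Type*} [MeasurableSpace Ω] {ν : Measure Ω} {p : ℝ≥0∞}
    (f : Lp 𝕜 p ν) :
    LpNonneg f ↔ lipschitzWith_rePosPart.compLp rePosPart_zero f = f := by
  have hc := lipschitzWith_rePosPart.coeFn_compLp rePosPart_zero f
  constructor
  · intro h
    apply Lp.ext
    filter_upwards [h, hc] with y h1 h2
    rw [h2, Function.comp_apply, rePosPart_eq_self_iff]
    exact h1
  · intro h
    rw [h] at hc
    filter_upwards [hc] with y h1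
    exact rePosPart_eq_self_iff.1 h1.symm

theorem sharpen_nonneg {A X : Type*} {e : A → X → ℝ} (he : ∀ a z, 0 ≤ e a z) (F : Finset A)
    (a : A) (z : X) : 0 ≤ sharpen e F a z := by
  unfold sharpen
  split_ifs
  · exact he a z
  · exact le_rfl

variable {ι : Type*} {κ : ι → Type*} [∀ i, Fintype (κ i)]
  {p : ℝ≥0∞} [Fact (1 ≤ p)] {U : Ultrafilter ι}

theorem norm_rePosPart_le (x : 𝕜) : ‖rePosPart x‖ ≤ ‖x‖ := by
  simpa [rePosPart_zero] using norm_rePosPart_sub_le x 0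

theorem norm_cls_rePosPart_sub_le (hp : p ≠ ∞) {g h : (Σ i, κ i) → 𝕜} (hg : SliceBdd p g)
    (hh : SliceBdd p h) :
    ‖cls p U (fun z => rePosPart (g z)) - cls p U (fun z => rePosPart (h z))‖
      ≤ ‖cls p U g - cls p U h‖ := by
  rw [← cls_sub U (hg.mono hp fun z => norm_rePosPart_le _)
    (hh.mono hp fun z => norm_rePosPart_le _), ← cls_sub U hg hh]
  exact norm_cls_le U hp (hg.sub hh) fun z => norm_rePosPart_sub_le _ _

namespace AsympDisjoint

variable {A : Type*} [TopologicalSpace A] [DiscreteTopology A] {e : A → (Σ i, κ i) → ℝ}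
  (he : AsympDisjoint 𝕜 p U e) (hp : p ≠ ∞)

include he hp

/-- The embedding commutes with positive parts on compactly supported continuous functions: the
members of the asymptotically disjoint family involved may be replaced by disjoint functions. -/
theorem cls_weightedTrace_rePosPart (h k : C_c(A × Ultrafilter (Σ i, κ i), 𝕜))
    (hk : ∀ y, k y = rePosPart (h y)) :
    cls p U (weightedTrace (fun a z => (e a z : 𝕜)) k)
      = cls p U (fun z => rePosPart (weightedTrace (fun a z => (e a z : 𝕜)) h z)) := by
  obtain ⟨F, hF⟩ := exists_finset_support h
  obtain ⟨C, -, hC⟩ := exists_norm_le h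
  have hFk : ∀ a ∉ F, ∀ x, k (a, x) = 0 := fun a ha x => by rw [hk, hF a ha, rePosPart_zero]
  have hCk : ∀ y, ‖k y‖ ≤ C := fun y => by
    rw [hk]; exact (norm_rePosPart_le _).trans (hC y)
  have h1 : weightedTrace (fun a z => (e a z : 𝕜)) h
      = fun z => ∑ a ∈ F, h (a, pure z) * (e a z : 𝕜) :=
    funext fun z => weightedTrace_eq_sum _ h hF z
  have h2 : weightedTrace (fun a z => (e a z : 𝕜)) k
      = fun z => ∑ a ∈ F, k (a, pure z) * (e a z : 𝕜) :=
    funext fun z => weightedTrace_eq_sum _ k hFk z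
  have hs1 := he.cls_sum_mul_sharpen hp F (h := fun a z => h (a, pure z)) fun a z => hC _
  have hs2 := he.cls_sum_mul_sharpen hp F (h := fun a z => k (a, pure z)) fun a z => hCk _
  have hb : SliceBdd p fun z => ∑ a ∈ F, h (a, pure z) * (e a z : 𝕜) :=
    SliceBdd.sum F (g := fun a z => h (a, pure z) * (e a z : 𝕜))
      fun a _ => he.bdd_mul hp a fun z => hC _
  have hb' : SliceBdd p fun z => ∑ a ∈ F, h (a, pure z) * (sharpen e F a z : 𝕜) :=
    SliceBdd.sum F (g := fun a z => h (a, pure z) * (sharpen e F a z : 𝕜))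
      fun a _ => (he.sharpen_bdd hp F a).bdd_mul hp fun z => hC _
  have h3 : cls p U (fun z => rePosPart (∑ a ∈ F, h (a, pure z) * (e a z : 𝕜)))
      = cls p U (fun z => rePosPart (∑ a ∈ F, h (a, pure z) * (sharpen e F a z : 𝕜))) := by
    have h4 := norm_cls_rePosPart_sub_le (U := U) hp hb hb'
    rw [hs1, sub_self, norm_zero] at h4
    exact sub_eq_zero.1 (norm_le_zero_iff.1 h4)
  rw [h1, h2, hs2, h3]
  refine congrArg _ (funext fun z => ?_)
  rw [map_sum_of_disjoint rePosPart rePosPart_zero]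
  · refine Finset.sum_congr rfl fun a _ => ?_
    rw [hk, rePosPart_mul_ofReal _ (sharpen_nonneg he.nonneg F a z)]
  · intro a ha b hb hab
    rcases sharpen_eq_zero_or e ha hb hab z with h0 | h0
    · left; rw [h0, RCLike.ofReal_zero, mul_zero]
    · right; rw [h0, RCLike.ofReal_zero, mul_zero]

variable [MeasurableSpace (A × Ultrafilter (Σ i, κ i))]
  [BorelSpace (A × Ultrafilter (Σ i, κ i))]

theorem lpToUltra_rePosPart (f : Lp 𝕜 p (he.measure hp)) {g : (Σ i, κ i) → 𝕜}
    (hg : SliceBdd p g) (hfg : he.lpToUltra hp f = cls p U g) :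
    he.lpToUltra hp (lipschitzWith_rePosPart.compLp rePosPart_zero f)
      = cls p U (fun z => rePosPart (g z)) := by
  refine eq_of_norm_sub_le_zero (le_of_forall_pos_le_add fun ε hε => ?_)
  rw [zero_add]
  obtain ⟨h, hlt⟩ := he.exists_cc_norm_sub_lt hp f (half_pos hε)
  have hhb := he.weightedTrace_bdd hp h
  let k : C_c(A × Ultrafilter (Σ i, κ i), 𝕜) :=
    h.compLeft ⟨rePosPart, lipschitzWith_rePosPart.continuous⟩
  have hk : ∀ y, k y = rePosPart (h y) := fun y =>
    CompactlySupportedContinuousMap.compLeft_apply rePosPart_zero h y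
  have hkLp : he.ccToLp hp k
      = lipschitzWith_rePosPart.compLp rePosPart_zero (he.ccToLp hp h) := by
    apply Lp.ext
    filter_upwards [(he.memLp_cc hp k).coeFn_toLp, (he.memLp_cc hp h).coeFn_toLp,
      lipschitzWith_rePosPart.coeFn_compLp rePosPart_zero (he.ccToLp hp h)] with y h1 h2 h3
    rw [h3, Function.comp_apply]
    change ((he.memLp_cc hp k).toLp k) y = rePosPart (((he.memLp_cc hp h).toLp h) y)
    rw [h1, h2, hk]
  have h1 : ‖he.lpToUltra hp (lipschitzWith_rePosPart.compLp rePosPart_zero f)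
      - he.lpToUltra hp (he.ccToLp hp k)‖ < ε / 2 := by
    rw [← map_sub, LinearIsometry.norm_map, hkLp]
    refine lt_of_le_of_lt ?_ hlt
    have := lipschitzWith_rePosPart.norm_compLp_sub_le rePosPart_zero f (he.ccToLp hp h)
    simpa using this
  have h2 : ‖he.lpToUltra hp (he.ccToLp hp k) - cls p U (fun z => rePosPart (g z))‖ < ε / 2 := by
    rw [he.lpToUltra_cc, he.cls_weightedTrace_rePosPart hp h k hk]
    refine (norm_cls_rePosPart_sub_le hp hhb hg).trans_lt ?_
    rw [← he.lpToUltra_cc hp h, ← hfg, ← map_sub, LinearIsometry.norm_map, norm_sub_rev]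
    exact hlt
  have h3 := norm_sub_le_norm_sub_add_norm_sub
    (he.lpToUltra hp (lipschitzWith_rePosPart.compLp rePosPart_zero f))
    (he.lpToUltra hp (he.ccToLp hp k)) (cls p U (fun z => rePosPart (g z)))
  linarith

end AsympDisjoint

/-- An element of the ultraproduct is nonnegative if it has a family of nonnegative
representatives. -/
def UltraNonneg (x : UltraLp 𝕜 U κ p) : Prop :=
  ∃ g : ∀ i, PiLp p (fun _ : κ i => 𝕜), ∃ hg, (∀ i, FunNonneg (g i)) ∧ ultraMk 𝕜 U g hg = x

/-- An ultraproduct of finite-dimensional `ℓ^p` spaces is an `L^p` space, with the same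
nonnegative elements. -/
theorem exists_lp_equiv_ultraLp {ι : Type u} {κ : ι → Type u} [∀ i, Fintype (κ i)]
    (U : Ultrafilter ι) (hp : p ≠ ∞) :
    ∃ (Ω : Type u) (_ : MeasurableSpace Ω) (ν : Measure Ω) (Θ : Lp 𝕜 p ν ≃ₗᵢ[𝕜] UltraLp 𝕜 U κ p),
      ∀ f, LpNonneg f ↔ UltraNonneg (Θ f) := by
  obtain ⟨A, e, he, hmax⟩ := exists_maximal_asympDisjoint (κ := κ) 𝕜 p U
  let _ : TopologicalSpace A := ⊥
  have : DiscreteTopology A := ⟨rfl⟩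
  let _ : MeasurableSpace (A × Ultrafilter (Σ i, κ i)) := borel _
  have : BorelSpace (A × Ultrafilter (Σ i, κ i)) := ⟨rfl⟩
  refine ⟨A × Ultrafilter (Σ i, κ i), inferInstance, he.measure hp,
    LinearIsometryEquiv.ofSurjective (he.lpToUltra hp) (he.lpToUltra_surjective hp hmax),
    fun f => ?_⟩
  change _ ↔ UltraNonneg (he.lpToUltra hp f)
  rw [lpNonneg_iff_compLp_eq]
  constructor
  · intro h
    obtain ⟨g, hg, hfg⟩ := exists_cls_eq U (he.lpToUltra hp f)
    have h1 := he.lpToUltra_rePosPart hp f hg hfg.symm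
    have hb : SliceBdd p (fun z => rePosPart (g z)) := hg.mono hp fun z => norm_rePosPart_le _
    refine ⟨slice p (fun z => rePosPart (g z)), hb, fun i z => ?_, ?_⟩
    · change 0 ≤ RCLike.re (rePosPart (g ⟨i, z⟩)) ∧ RCLike.im (rePosPart (g ⟨i, z⟩)) = 0
      simp [rePosPart]
    · rw [← cls_of_bdd U hb, ← h1, h]
  · rintro ⟨g, hg, hg0, hfg⟩
    have hb : SliceBdd p (fun z : Σ i, κ i => g z.1 z.2) := hg
    have h1 : he.lpToUltra hp f = cls p U (fun z : Σ i, κ i => g z.1 z.2) := by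
      rw [← hfg, cls_of_bdd U hb]
      rfl
    have h2 := he.lpToUltra_rePosPart hp f hb h1
    have h3 : (fun z : Σ i, κ i => rePosPart (g z.1 z.2)) = fun z => g z.1 z.2 :=
      funext fun z => rePosPart_eq_self_iff.2 (hg0 z.1 z.2)
    rw [h3, ← h1] at h2
    exact (he.lpToUltra hp).injective h2

end Positivity

/-! ### Discretization of `L^p` -/

noncomputable section Discretization

open Filter Topology

theorem Lp.norm_rpow_toReal {𝕜 Ω : Type*} [RCLike 𝕜] [MeasurableSpace Ω] {μ : Measure Ω} {p : ℝ≥0∞}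
    [Fact (1 ≤ p)] (hp : p ≠ ∞) (f : Lp 𝕜 p μ) :
    ‖f‖ ^ p.toReal = ∫ x, ‖f x‖ ^ p.toReal ∂μ := by
  have h0 : p ≠ 0 := (zero_lt_one.trans_le Fact.out).ne'
  have h1 : 0 < p.toReal := ENNReal.toReal_pos h0 hp
  have h2 : 0 ≤ ∫ x, ‖f x‖ ^ p.toReal ∂μ := integral_nonneg fun x => by positivity
  rw [Lp.norm_def, (Lp.memLp f).eLpNorm_eq_integral_rpow_norm h0 hp, ENNReal.toReal_ofReal
    (by positivity), ← Real.rpow_mul h2, inv_mul_cancel₀ h1.ne', Real.rpow_one]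

variable {𝕜 : Type*} [RCLike 𝕜] {Ω : Type*} [MeasurableSpace Ω] {μ : Measure Ω} {p : ℝ≥0∞}
  [Fact (1 ≤ p)] {I : Type*} {B : I → Set Ω}

theorem Lp.integrableOn_of_ne_top (f : Lp 𝕜 p μ) {s : Set Ω} (hs : μ s ≠ ∞) :
    IntegrableOn f s μ := by
  have : IsFiniteMeasure (μ.restrict s) := ⟨by simpa using hs.lt_top⟩
  exact ((Lp.memLp f).restrict s).integrable Fact.out

/-- Jensen's inequality on a block. -/
theorem Lp.norm_setIntegral_rpow_le (hp : p ≠ ∞) (f : Lp 𝕜 p μ) {s : Set Ω}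
    (hμ : μ s ≠ ∞) : (μ.real s ^ (p.toReal⁻¹ - 1) * ‖∫ ω in s, f ω ∂μ‖) ^ p.toReal ≤
      ∫ ω in s, ‖f ω‖ ^ p.toReal ∂μ := by
  have hq := one_le_toReal_of_fact (p := p) hp
  have hint := Lp.integrableOn_of_ne_top f hμ
  have hint2 : Integrable (fun ω => ‖f ω‖ ^ p.toReal) μ :=
    (Lp.memLp f).integrable_norm_rpow (zero_lt_one.trans_le Fact.out).ne' hp
  have h0 : 0 ≤ ∫ ω in s, ‖f ω‖ ^ p.toReal ∂μ := integral_nonneg fun x => by positivity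
  rcases eq_or_ne (μ s) 0 with hs | hs
  · rw [setIntegral_measure_zero _ hs, norm_zero, mul_zero, Real.zero_rpow (by linarith)]
    exact h0
  have hw : 0 < μ.real s := ENNReal.toReal_pos hs hμ
  have h1 := (convexOn_rpow hq).map_set_average_le
    (Real.continuous_rpow_const (by linarith)).continuousOn isClosed_Ici hs hμ
    (Eventually.of_forall fun ω => norm_nonneg (f ω)) hint.norm hint2.integrableOn
  simp only [setAverage_eq, smul_eq_mul] at h1
  have h2 : ‖∫ ω in s, f ω ∂μ‖ ≤ ∫ ω in s, ‖f ω‖ ∂μ := norm_integral_le_integral_norm _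
  calc _ ≤ (μ.real s ^ p.toReal⁻¹ * ((μ.real s)⁻¹ * ∫ ω in s, ‖f ω‖ ∂μ)) ^ p.toReal := by
        rw [Real.rpow_sub hw, Real.rpow_one, div_eq_mul_inv, mul_assoc]
        gcongr
    _ = μ.real s * ((μ.real s)⁻¹ * ∫ ω in s, ‖f ω‖ ∂μ) ^ p.toReal := by
        rw [Real.mul_rpow (by positivity) (mul_nonneg (by positivity)
          (integral_nonneg fun x => norm_nonneg _)), ← Real.rpow_mul hw.le,
          inv_mul_cancel₀ (by linarith), Real.rpow_one]
    _ ≤ μ.real s * ((μ.real s)⁻¹ * ∫ ω in s, ‖f ω‖ ^ p.toReal ∂μ) := by gcongr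
    _ = _ := mul_inv_cancel_left₀ hw.ne' _

/-- The coefficient map of the step functions on the blocks `B i`: normalized integration over each
block. -/
def stepCoeff (𝕜 : Type*) [RCLike 𝕜] (p : ℝ≥0∞) [Fact (1 ≤ p)] (hμ : ∀ i, μ (B i) ≠ ∞) :
    Lp 𝕜 p μ →ₗ[𝕜] PiLp p (fun _ : I => 𝕜) where
  toFun f := WithLp.toLp p fun i =>
    ((μ.real (B i) ^ (p.toReal⁻¹ - 1) : ℝ) : 𝕜) * ∫ ω in B i, f ω ∂μ
  map_add' f g := by
    ext i
    have h : ∫ ω in B i, (f + g) ω ∂μ = ∫ ω in B i, f ω ∂μ + ∫ ω in B i, g ω ∂μ := by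
      rw [← integral_add (Lp.integrableOn_of_ne_top f (hμ i)) (Lp.integrableOn_of_ne_top g (hμ i))]
      exact integral_congr_ae (ae_restrict_of_ae (Lp.coeFn_add f g))
    change _ * (∫ ω in B i, (f + g) ω ∂μ) = _
    rw [h, mul_add]
    rfl
  map_smul' c f := by
    ext i
    have h : ∫ ω in B i, (c • f) ω ∂μ = c * ∫ ω in B i, f ω ∂μ := by
      rw [← integral_const_mul]
      exact integral_congr_ae (ae_restrict_of_ae (Lp.coeFn_smul c f))
    change _ * (∫ ω in B i, (c • f) ω ∂μ) = c * (_ * (∫ ω in B i, f ω ∂μ))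
    rw [h, mul_left_comm]

theorem stepCoeff_apply (hμ : ∀ i, μ (B i) ≠ ∞) (f : Lp 𝕜 p μ) (i : I) :
    stepCoeff 𝕜 p hμ f i =
      ((μ.real (B i) ^ (p.toReal⁻¹ - 1) : ℝ) : 𝕜) * ∫ ω in B i, f ω ∂μ := rfl

theorem funNonneg_stepCoeff (hμ : ∀ i, μ (B i) ≠ ∞) {f : Lp 𝕜 p μ} (hf : LpNonneg f) :
    FunNonneg (stepCoeff 𝕜 p hμ f) := by
  intro i
  have h : ∫ ω in B i, f ω ∂μ = ((∫ ω in B i, RCLike.re (f ω) ∂μ : ℝ) : 𝕜) := by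
    rw [← integral_ofReal]
    refine integral_congr_ae (ae_restrict_of_ae ?_)
    filter_upwards [hf] with ω hω
    conv_lhs => rw [← RCLike.re_add_im (f ω), hω.2]
    simp
  have h2 : 0 ≤ ∫ ω in B i, RCLike.re (f ω) ∂μ :=
    integral_nonneg_of_ae (ae_restrict_of_ae (hf.mono fun ω hω => hω.1))
  rw [stepCoeff_apply, h, ← RCLike.ofReal_mul, RCLike.ofReal_re, RCLike.ofReal_im]
  exact ⟨by positivity, rfl⟩

variable [Fintype I]

/-- The inclusion of step functions on the blocks `B i`: the `i`-th basis vector is sent to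
`μ(B i)^(-1/p)` times the indicator of `B i`, hence to `0` if the block is null. -/
def stepEmb (𝕜 : Type*) [RCLike 𝕜] (p : ℝ≥0∞) [Fact (1 ≤ p)] (hB : ∀ i, MeasurableSet (B i))
    (hμ : ∀ i, μ (B i) ≠ ∞) : PiLp p (fun _ : I => 𝕜) →L[𝕜] Lp 𝕜 p μ :=
  ∑ i, (PiLp.proj p (fun _ : I => 𝕜) i).smulRight
    (((μ.real (B i) ^ (-p.toReal⁻¹) : ℝ) : 𝕜) • indicatorConstLp p (hB i) (hμ i) (1 : 𝕜))

theorem stepEmb_apply (hB : ∀ i, MeasurableSet (B i)) (hμ : ∀ i, μ (B i) ≠ ∞)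
    (x : PiLp p (fun _ : I => 𝕜)) : stepEmb 𝕜 p hB hμ x = ∑ i, x i •
      ((μ.real (B i) ^ (-p.toReal⁻¹) : ℝ) : 𝕜) • indicatorConstLp p (hB i) (hμ i) (1 : 𝕜) := by
  simp [stepEmb]

theorem coeFn_stepEmb (hB : ∀ i, MeasurableSet (B i)) (hμ : ∀ i, μ (B i) ≠ ∞)
    (x : PiLp p (fun _ : I => 𝕜)) : stepEmb 𝕜 p hB hμ x =ᵐ[μ] fun ω =>
      ∑ i, (B i).indicator (fun _ => x i * ((μ.real (B i) ^ (-p.toReal⁻¹) : ℝ) : 𝕜)) ω := by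
  rw [stepEmb_apply]
  refine (Lp.coeFn_finsetSum _ _).trans ?_
  have h : ∀ i, (x i • ((μ.real (B i) ^ (-p.toReal⁻¹) : ℝ) : 𝕜) •
      indicatorConstLp p (hB i) (hμ i) (1 : 𝕜) : Lp 𝕜 p μ) =ᵐ[μ]
      (B i).indicator (fun _ => x i * ((μ.real (B i) ^ (-p.toReal⁻¹) : ℝ) : 𝕜)) := by
    intro i
    rw [smul_smul]
    refine (Lp.coeFn_smul _ _).trans ?_
    filter_upwards [indicatorConstLp_coeFn (p := p) (hs := hB i) (hμs := hμ i) (c := (1 : 𝕜))]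
      with ω hω
    rw [Pi.smul_apply, hω]
    by_cases h : ω ∈ B i <;> simp [h]
  filter_upwards [ae_all_iff.2 h] with ω hω
  simp only [Finset.sum_apply, hω]

theorem norm_stepEmb_le (hp : p ≠ ∞) (hB : ∀ i, MeasurableSet (B i)) (hμ : ∀ i, μ (B i) ≠ ∞)
    (hd : Pairwise (Function.onFun Disjoint B)) : ‖stepEmb 𝕜 p hB hμ‖ ≤ 1 := by
  have hq := one_le_toReal_of_fact (p := p) hp
  refine ContinuousLinearMap.opNorm_le_bound _ zero_le_one fun x => ?_
  rw [one_mul, ← Real.rpow_le_rpow_iff (norm_nonneg _) (norm_nonneg _) (by linarith : 0 < p.toReal),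
    Lp.norm_rpow_toReal hp, PiLp.norm_rpow_toReal hp]
  have h1 : ∀ᵐ ω ∂μ, ‖stepEmb 𝕜 p hB hμ x ω‖ ^ p.toReal = ∑ i, (B i).indicator
      (fun _ => ‖x i * ((μ.real (B i) ^ (-p.toReal⁻¹) : ℝ) : 𝕜)‖ ^ p.toReal) ω := by
    filter_upwards [coeFn_stepEmb hB hμ x] with ω hω
    rw [hω]
    by_cases h : ∃ i, ω ∈ B i
    · obtain ⟨i, hi⟩ := h
      have hj : ∀ j, j ≠ i → ω ∉ B j := fun j hj hωj => Set.disjoint_left.1 (hd hj) hωj hi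
      rw [Finset.sum_eq_single i (fun j _ h => by simp [hj j h]) (by simp),
        Finset.sum_eq_single i (fun j _ h => by simp [hj j h]) (by simp)]
      simp [hi]
    · push Not at h
      simp [h, Real.zero_rpow (by linarith : p.toReal ≠ 0)]
  rw [integral_congr_ae h1, integral_finsetSum _ fun i _ =>
    (integrable_indicator_iff (hB i)).2 (integrableOn_const (hμ i))]
  refine Finset.sum_le_sum fun i _ => ?_
  rw [integral_indicator (hB i), setIntegral_const, smul_eq_mul, norm_mul,
    Real.mul_rpow (norm_nonneg _) (norm_nonneg _), RCLike.norm_ofReal,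
    abs_of_nonneg (by positivity), ← Real.rpow_mul (by positivity), neg_mul,
    inv_mul_cancel₀ (by linarith), Real.rpow_neg_one]
  rcases eq_or_ne (μ.real (B i)) 0 with h | h
  · rw [h]; simp; positivity
  · rw [mul_comm, mul_assoc, inv_mul_cancel₀ h, mul_one]

theorem lpNonneg_stepEmb (hB : ∀ i, MeasurableSet (B i)) (hμ : ∀ i, μ (B i) ≠ ∞)
    {x : PiLp p (fun _ : I => 𝕜)} (hx : FunNonneg x) : LpNonneg (stepEmb 𝕜 p hB hμ x) := by
  filter_upwards [coeFn_stepEmb hB hμ x] with ω hω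
  rw [hω, map_sum, map_sum]
  refine ⟨Finset.sum_nonneg fun i _ => ?_, Finset.sum_eq_zero fun i _ => ?_⟩
  · by_cases h : ω ∈ B i
    · simpa [h, (hx i).2] using mul_nonneg (hx i).1 (by positivity)
    · simp [h]
  · by_cases h : ω ∈ B i <;> simp [h, (hx i).2]

theorem norm_stepCoeff_le (hp : p ≠ ∞) (hB : ∀ i, MeasurableSet (B i)) (hμ : ∀ i, μ (B i) ≠ ∞)
    (hd : Pairwise (Function.onFun Disjoint B)) (f : Lp 𝕜 p μ) : ‖stepCoeff 𝕜 p hμ f‖ ≤ ‖f‖ := by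
  have hq := one_le_toReal_of_fact (p := p) hp
  have hint : Integrable (fun ω => ‖f ω‖ ^ p.toReal) μ :=
    (Lp.memLp f).integrable_norm_rpow (zero_lt_one.trans_le Fact.out).ne' hp
  rw [← Real.rpow_le_rpow_iff (norm_nonneg _) (norm_nonneg _) (by linarith : 0 < p.toReal),
    Lp.norm_rpow_toReal hp, PiLp.norm_rpow_toReal hp]
  calc _ ≤ ∑ i, ∫ ω in B i, ‖f ω‖ ^ p.toReal ∂μ := by
        refine Finset.sum_le_sum fun i _ => ?_
        rw [stepCoeff_apply, norm_mul, RCLike.norm_ofReal, abs_of_nonneg (by positivity)]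
        exact Lp.norm_setIntegral_rpow_le hp f (hμ i)
    _ = ∫ ω in ⋃ i, B i, ‖f ω‖ ^ p.toReal ∂μ :=
        (integral_iUnion_fintype hB hd fun i => hint.integrableOn).symm
    _ ≤ _ := setIntegral_le_integral hint (Eventually.of_forall fun ω => by positivity)

theorem stepEmb_stepCoeff_indicator (hp : p ≠ ∞) (hB : ∀ i, MeasurableSet (B i))
    (hμ : ∀ i, μ (B i) ≠ ∞)
    (hd : Pairwise (Function.onFun Disjoint B)) (i : I) :
    stepEmb 𝕜 p hB hμ (stepCoeff 𝕜 p hμ (indicatorConstLp p (hB i) (hμ i) 1)) =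
      indicatorConstLp p (hB i) (hμ i) 1 := by
  have h1 : ∀ j, ∫ ω in B j, indicatorConstLp p (hB i) (hμ i) (1 : 𝕜) ω ∂μ =
      ((μ.real (B i ∩ B j) : ℝ) : 𝕜) := fun j => by
    rw [setIntegral_indicatorConstLp (hB j)]
    simp [RCLike.real_smul_eq_coe_mul]
  rw [stepEmb_apply, Finset.sum_eq_single i]
  · rw [stepCoeff_apply, h1, Set.inter_self, smul_smul, ← RCLike.ofReal_mul, ← RCLike.ofReal_mul]
    rcases eq_or_ne (μ (B i)) 0 with h | h
    · have : indicatorConstLp p (hB i) (hμ i) (1 : 𝕜) = 0 := by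
        rw [← norm_eq_zero, norm_indicatorConstLp (zero_lt_one.trans_le Fact.out).ne' hp]
        have hq := one_le_toReal_of_fact (p := p) hp
        simp [Measure.real, h, Real.zero_rpow (inv_ne_zero (by linarith : p.toReal ≠ 0))]
      rw [this, smul_zero]
    · have hw : 0 < μ.real (B i) := ENNReal.toReal_pos h (hμ i)
      have : μ.real (B i) ^ (p.toReal⁻¹ - 1) * μ.real (B i) * μ.real (B i) ^ (-p.toReal⁻¹) = 1 := by
        rw [← Real.rpow_add_one hw.ne', ← Real.rpow_add hw]
        simp
      rw [this, RCLike.ofReal_one, one_smul]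
  · intro j _ hj
    rw [stepCoeff_apply, h1, (hd hj.symm).inter_eq]
    simp
  · simp

/-- Indicators of unions of blocks are fixed by the averaging operator of the blocks. -/
theorem stepEmb_stepCoeff_indicator_biUnion (hp : p ≠ ∞) (hB : ∀ i, MeasurableSet (B i))
    (hμ : ∀ i, μ (B i) ≠ ∞) (hd : Pairwise (Function.onFun Disjoint B)) (s : Finset I) {A : Set Ω}
    (hA : MeasurableSet A) (hAμ : μ A ≠ ∞) (h : A = ⋃ i ∈ s, B i) :
    stepEmb 𝕜 p hB hμ (stepCoeff 𝕜 p hμ (indicatorConstLp p hA hAμ 1)) =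
      indicatorConstLp p hA hAμ 1 := by
  have hsum : indicatorConstLp p hA hAμ (1 : 𝕜) =
      ∑ i ∈ s, indicatorConstLp p (hB i) (hμ i) 1 := by
    apply Lp.ext
    refine EventuallyEq.trans ?_ (Lp.coeFn_finsetSum _ _).symm
    have h1 := fun i =>
      indicatorConstLp_coeFn (p := p) (hs := hB i) (hμs := hμ i) (c := (1 : 𝕜))
    filter_upwards [ae_all_iff.2 h1,
      indicatorConstLp_coeFn (p := p) (hs := hA) (hμs := hAμ) (c := (1 : 𝕜))] with ω h1 h2
    rw [h2, Finset.sum_apply, h,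
      Finset.indicator_biUnion_apply s B fun i _ j _ hij => hd hij]
    simp only [h1]
  rw [hsum, map_sum, map_sum]
  exact Finset.sum_congr rfl fun i _ => stepEmb_stepCoeff_indicator hp hB hμ hd i

/-- Contractive positive discretization of `L^p` fixing finitely many indicator functions; the
blocks are the atoms of the algebra generated by the given sets. -/
theorem exists_discretization (𝕜 : Type*) [RCLike 𝕜] {Ω : Type u} [MeasurableSpace Ω]
    {μ : Measure Ω} {p : ℝ≥0∞} [Fact (1 ≤ p)] (hp : p ≠ ∞)
    (F : Finset {A : Set Ω // MeasurableSet A ∧ μ A ≠ ∞}) :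
    ∃ (I : Type u) (_ : Fintype I) (J : PiLp p (fun _ : I => 𝕜) →L[𝕜] Lp 𝕜 p μ)
      (R : Lp 𝕜 p μ →L[𝕜] PiLp p (fun _ : I => 𝕜)),
      ‖J‖ ≤ 1 ∧ ‖R‖ ≤ 1 ∧ (∀ x : PiLp p (fun _ : I => 𝕜), FunNonneg x → LpNonneg (J x)) ∧
      (∀ f : Lp 𝕜 p μ, LpNonneg f → FunNonneg (R f)) ∧
      ∀ A ∈ F, J (R (indicatorConstLp p A.2.1 A.2.2 1)) = indicatorConstLp p A.2.1 A.2.2 1 := by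
  classical
  -- The atom `B S` consists of the points that lie in exactly those sets of `F` that belong to `S`.
  let B : {S // S ∈ F.powerset.erase ∅} → Set Ω := fun S =>
    ⋂ A ∈ F, if A ∈ S.1 then A.1 else (A.1)ᶜ
  have hmem : ∀ S ω, ω ∈ B S ↔ ∀ A ∈ F, (ω ∈ A.1 ↔ A ∈ S.1) := by
    intro S ω
    simp only [B, Set.mem_iInter]
    refine forall₂_congr fun A _ => ?_
    by_cases h : A ∈ S.1 <;> simp [h]
  have hS : ∀ S : {S // S ∈ F.powerset.erase ∅}, S.1 ⊆ F ∧ S.1.Nonempty := fun S =>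
    ⟨Finset.mem_powerset.1 (Finset.mem_of_mem_erase S.2),
      Finset.nonempty_iff_ne_empty.2 (Finset.ne_of_mem_erase S.2)⟩
  have hB : ∀ S, MeasurableSet (B S) := fun S =>
    F.measurableSet_biInter fun A _ => by split_ifs; exacts [A.2.1, A.2.1.compl]
  have hsub : ∀ S, ∀ A ∈ S.1, B S ⊆ A.1 := fun S A hA ω hω =>
    ((hmem S ω).1 hω A ((hS S).1 hA)).2 hA
  have hμ : ∀ S, μ (B S) ≠ ∞ := fun S => by
    obtain ⟨A, hA⟩ := (hS S).2
    exact measure_ne_top_of_subset (hsub S A hA) A.2.2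
  have hd : Pairwise (Function.onFun Disjoint B) := by
    intro S S' hne
    rw [Function.onFun, Set.disjoint_left]
    intro ω h1 h2
    refine hne (Subtype.ext (Finset.ext fun A => ?_))
    have key : ∀ S, ω ∈ B S → (A ∈ S.1 ↔ A ∈ F ∧ ω ∈ A.1) := fun S h =>
      ⟨fun hA => ⟨(hS S).1 hA, hsub S A hA h⟩, fun hA => ((hmem S ω).1 h A hA.1).1 hA.2⟩
    rw [key S h1, key S' h2]
  refine ⟨{S // S ∈ F.powerset.erase ∅}, inferInstance, stepEmb 𝕜 p hB hμ,
    (stepCoeff 𝕜 p hμ).mkContinuous 1 fun f => by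
    rw [one_mul]; exact norm_stepCoeff_le hp hB hμ hd f, norm_stepEmb_le hp hB hμ hd,
    LinearMap.mkContinuous_norm_le _ zero_le_one _, fun x => lpNonneg_stepEmb hB hμ,
    fun f => funNonneg_stepCoeff hμ, fun A hA => ?_⟩
  refine stepEmb_stepCoeff_indicator_biUnion hp hB hμ hd {S | A ∈ S.1} A.2.1 A.2.2
    (Set.Subset.antisymm (fun ω hω => ?_)
      (Set.iUnion₂_subset fun S h => hsub S A (by simpa using h)))
  have hS₀ : F.filter (fun A => ω ∈ A.1) ∈ F.powerset.erase ∅ :=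
    Finset.mem_erase.2 ⟨Finset.nonempty_iff_ne_empty.1 ⟨A, by simp [hA, hω]⟩, by simp⟩
  exact Set.mem_iUnion₂.2 ⟨⟨_, hS₀⟩, by simp [hA, hω], (hmem _ _).2 fun A' hA' => by simp [hA']⟩

/-- Contractions that fix finitely many prescribed indicator functions converge strongly to the
identity of `L^p`. -/
theorem tendsto_of_fix_indicators {𝕜 : Type*} [RCLike 𝕜] {Ω : Type u} [MeasurableSpace Ω]
    {μ : Measure Ω} {p : ℝ≥0∞} [Fact (1 ≤ p)] (hp : p ≠ ∞) {ι : Type*} {l : Filter ι}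
    {K : ι → Lp 𝕜 p μ →L[𝕜] Lp 𝕜 p μ} (hK : ∀ i, ‖K i‖ ≤ 1)
    (hfix : ∀ (A : Set Ω) (hA : MeasurableSet A) (hAμ : μ A ≠ ∞),
      ∀ᶠ i in l, K i (indicatorConstLp p hA hAμ 1) = indicatorConstLp p hA hAμ 1)
    (f : Lp 𝕜 p μ) : Tendsto (fun i => K i f) l (𝓝 f) := by
  have hK' : ∀ i x, ‖K i x‖ ≤ ‖x‖ := fun i x => norm_apply_le_of_norm_le_one (hK i) x
  induction f using Lp.induction hp with
  | @indicatorConst c s hs hμs =>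
    have h : ∀ᶠ i in l, K i (Lp.simpleFunc.indicatorConst p hs hμs.ne c : Lp 𝕜 p μ) =
        Lp.simpleFunc.indicatorConst p hs hμs.ne c := by
      have hc : (Lp.simpleFunc.indicatorConst p hs hμs.ne c : Lp 𝕜 p μ) =
          c • indicatorConstLp p hs hμs.ne 1 := by
        rw [Lp.simpleFunc.coe_indicatorConst]
        apply Lp.ext
        refine EventuallyEq.trans ?_ (Lp.coeFn_smul _ _).symm
        filter_upwards [indicatorConstLp_coeFn (p := p) (hs := hs) (hμs := hμs.ne) (c := c),
          indicatorConstLp_coeFn (p := p) (hs := hs) (hμs := hμs.ne) (c := (1 : 𝕜))] with ω h1 h2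
        rw [h1, Pi.smul_apply, h2]
        by_cases h : ω ∈ s <;> simp [h]
      filter_upwards [hfix _ hs hμs.ne] with i hi
      rw [hc, map_smul, hi]
    exact tendsto_const_nhds.congr' (h.mono fun i hi => hi.symm)
  | add hf hg _ h1 h2 =>
    simpa only [map_add] using h1.add h2
  | isClosed =>
    refine isClosed_of_closure_subset fun f hf => ?_
    change Tendsto (fun i => K i f) l (𝓝 f)
    rw [Metric.tendsto_nhds]
    intro ε hε
    obtain ⟨g, hg, hd⟩ := Metric.mem_closure_iff.1 hf (ε / 3) (by positivity)
    have hg' : Tendsto (fun i => K i g) l (𝓝 g) := hg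
    filter_upwards [Metric.tendsto_nhds.1 hg' (ε / 3) (by positivity)] with i hi
    have h1 : dist (K i f) (K i g) ≤ dist f g := by
      rw [dist_eq_norm, dist_eq_norm, ← map_sub]; exact hK' i _
    have h2 := dist_triangle4 (K i f) (K i g) g f
    rw [dist_comm g f] at h2
    linarith

end Discretization

/-! ### The dilation -/

section Dilation

open Filter Topology

/-- An approximate dilation of `T` on a finite-dimensional `ℓ^p` space: `W` is a permutation of the
coordinates, `E` is the projection and `V` is the embedding, isometric up to the error of the
contraction `K`, which fixes the indicators of the finitely many sets in `F`. -/
theorem exists_approx_dilation {𝕜 : Type*} [RCLike 𝕜] {Ω : Type u} [MeasurableSpace Ω]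
    {μ : Measure Ω} {p : ℝ≥0∞} [Fact (1 ≤ p)] (hp : p ≠ ∞) (T : Lp 𝕜 p μ →L[𝕜] Lp 𝕜 p μ)
    (hTpos : LpPositive T) (hT : ‖T‖ ≤ 1) (F : Finset {A : Set Ω // MeasurableSet A ∧ μ A ≠ ∞})
    (n : ℕ) :
    ∃ (Z : Type u) (_ : Fintype Z)
      (W : PiLp p (fun _ : Z => 𝕜) ≃ₗᵢ[𝕜] PiLp p (fun _ : Z => 𝕜))
      (V : Lp 𝕜 p μ →L[𝕜] PiLp p (fun _ : Z => 𝕜))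
      (E : PiLp p (fun _ : Z => 𝕜) →L[𝕜] PiLp p (fun _ : Z => 𝕜))
      (K : Lp 𝕜 p μ →L[𝕜] Lp 𝕜 p μ),
      (∀ x : PiLp p (fun _ : Z => 𝕜), FunNonneg x → FunNonneg (W x)) ∧
      (∀ f : Lp 𝕜 p μ, LpNonneg f → FunNonneg (V f)) ∧
      (∀ x : PiLp p (fun _ : Z => 𝕜), FunNonneg x → FunNonneg (E x)) ∧
      (∀ x, E (E x) = E x) ∧ ‖V‖ ≤ 1 ∧ ‖E‖ ≤ 1 ∧ ‖K‖ ≤ 1 ∧ (∀ f, ‖K f‖ ≤ ‖V f‖) ∧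
      (∀ A ∈ F, K (indicatorConstLp p A.2.1 A.2.2 1) = indicatorConstLp p A.2.1 A.2.2 1) ∧
      ∀ (k : ℕ) f, ‖E ((W ^ k) (V f)) - V ((T ^ k) f)‖ ≤ 2 * k / (n + 1) * ‖f‖ +
        ∑ j ∈ Finset.range k, (‖K ((T ^ j) f) - (T ^ j) f‖ + 1 / (n + 1) * ‖f‖) := by
  obtain ⟨I, _, J, R, hJ, hR, hJpos, hRpos, hfix⟩ := exists_discretization 𝕜 hp F
  have hJ' : ∀ x, ‖J x‖ ≤ ‖x‖ := norm_apply_le_of_norm_le_one hJ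
  have hR' : ∀ x, ‖R x‖ ≤ ‖x‖ := norm_apply_le_of_norm_le_one hR
  have hT' : ∀ x, ‖T x‖ ≤ ‖x‖ := norm_apply_le_of_norm_le_one hT
  have hn : (0 : ℝ) < n + 1 := by positivity
  -- The discretized operator is scaled down to become a strict contraction.
  obtain ⟨r, hr0, hr1, hr⟩ : ∃ r : ℝ, 0 ≤ r ∧ r < 1 ∧ 1 - r ≤ 1 / (n + 1) := by
    refine ⟨1 - 1 / (n + 1), ?_, ?_, by linarith⟩
    · have : 1 / ((n : ℝ) + 1) ≤ 1 := by rw [div_le_one hn]; linarith [n.cast_nonneg (α := ℝ)]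
      linarith
    · have : 0 < 1 / ((n : ℝ) + 1) := by positivity
      linarith
  let A : PiLp p (fun _ : I => 𝕜) →L[𝕜] PiLp p (fun _ : I => 𝕜) := (r : 𝕜) • (R ∘L T ∘L J)
  have hA' : ∀ x, A x = (r : 𝕜) • R (T (J x)) := fun x => rfl
  have hAle : ∀ x, ‖A x‖ ≤ r * ‖x‖ := fun x => by
    rw [hA', norm_smul, RCLike.norm_ofReal, abs_of_nonneg hr0]
    gcongr
    exact (hR' _).trans ((hT' _).trans (hJ' _))
  have hA1 : ‖A‖ < 1 := (A.opNorm_le_bound hr0 hAle).trans_lt hr1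
  have hApos : ∀ f : PiLp p (fun _ : I => 𝕜), FunNonneg f → FunNonneg (A f) := by
    intro f hf z
    have := hRpos _ (hTpos _ (hJpos f hf)) z
    rw [hA']
    simp only [PiLp.smul_apply, smul_eq_mul, RCLike.re_ofReal_mul, RCLike.im_ofReal_mul, this.2,
      mul_zero, and_true]
    exact mul_nonneg hr0 this.1
  obtain ⟨Z, _, σ, D, Q, hD, hQpos, hQ, hQD, hdil⟩ := exists_finite_dilation hp A hA1 hApos n
  have hQ' : ∀ x, ‖Q x‖ ≤ ‖x‖ := norm_apply_le_of_norm_le_one hQ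
  have hD' : ‖D.toContinuousLinearMap‖ ≤ 1 := D.norm_toContinuousLinearMap_le
  refine ⟨Z, inferInstance, LinearIsometryEquiv.piLpCongrLeft p 𝕜 𝕜 σ,
    D.toContinuousLinearMap ∘L R, D.toContinuousLinearMap ∘L Q, J ∘L R, fun x hx z => ?_,
    fun f hf => hD _ (hRpos f hf), fun x hx => hD _ (hQpos x hx), fun x => ?_, ?_, ?_, ?_,
    fun f => ?_, hfix, fun k f => ?_⟩
  · simpa using hx (σ.symm z)
  · exact congrArg D (hQD _)
  · exact ContinuousLinearMap.opNorm_le_bound _ zero_le_one fun x => by simpa using hR' x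
  · exact ContinuousLinearMap.opNorm_le_bound _ zero_le_one fun x => by simpa using hQ' x
  · exact ContinuousLinearMap.opNorm_le_bound _ zero_le_one fun x => by
      simpa using (hJ' _).trans (hR' x)
  · simpa using hJ' (R f)
  · have hTk : ∀ j, ‖(T ^ j) f‖ ≤ ‖f‖ := by
      intro j
      induction j with
      | zero => simp
      | succ j ih => rw [pow_succ']; exact (hT' _).trans ih
    have hind : ‖(A ^ k) (R f) - R ((T ^ k) f)‖ ≤ ∑ j ∈ Finset.range k,
        (‖J (R ((T ^ j) f)) - (T ^ j) f‖ + 1 / (n + 1) * ‖f‖) := by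
      induction k with
      | zero => simp
      | succ k ih =>
        rw [Finset.sum_range_succ, pow_succ', pow_succ']
        set g := (T ^ k) f
        change ‖A ((A ^ k) (R f)) - R (T g)‖ ≤ _
        have hsplit : A ((A ^ k) (R f)) - R (T g) = A ((A ^ k) (R f) - R g) +
            ((r : 𝕜) • R (T (J (R g) - g)) - ((1 - r : ℝ) : 𝕜) • R (T g)) := by
          rw [map_sub A, hA' (R g), map_sub T, map_sub R]
          push_cast
          module
        rw [hsplit]
        refine (norm_add_le _ _).trans (add_le_add ?_ ((norm_sub_le _ _).trans (add_le_add ?_ ?_)))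
        · refine ((hAle _).trans ?_).trans ih
          exact mul_le_of_le_one_left (norm_nonneg _) hr1.le
        · rw [norm_smul, RCLike.norm_ofReal, abs_of_nonneg hr0]
          exact (mul_le_of_le_one_left (norm_nonneg _) hr1.le).trans ((hR' _).trans (hT' _))
        · rw [norm_smul, RCLike.norm_ofReal, abs_of_nonneg (by linarith)]
          exact mul_le_mul hr ((hR' _).trans ((hT' _).trans (hTk k))) (norm_nonneg _)
            (by positivity)
    have h1 : ‖D (Q (((LinearIsometryEquiv.piLpCongrLeft p 𝕜 𝕜 σ) ^ k) (D (R f)))) -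
        D (R ((T ^ k) f))‖ ≤ ‖Q (((LinearIsometryEquiv.piLpCongrLeft p 𝕜 𝕜 σ) ^ k) (D (R f))) -
          (A ^ k) (R f)‖ + ‖(A ^ k) (R f) - R ((T ^ k) f)‖ := by
      rw [← map_sub, D.norm_map]
      exact norm_sub_le_norm_sub_add_norm_sub _ _ _
    refine h1.trans (add_le_add ((hdil k (R f)).trans ?_) hind)
    gcongr
    exact hR' f

theorem UltraNonneg.ultraMap {𝕜 : Type*} [RCLike 𝕜] {ι : Type*} {κ : ι → Type*}
    [∀ i, Fintype (κ i)] {p : ℝ≥0∞} [Fact (1 ≤ p)] {U : Ultrafilter ι}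
    {L : ∀ i, PiLp p (fun _ : κ i => 𝕜) →L[𝕜] PiLp p (fun _ : κ i => 𝕜)} (hL : ∀ i, ‖L i‖ ≤ 1)
    (hpos : ∀ i (x : PiLp p (fun _ : κ i => 𝕜)), FunNonneg x → FunNonneg (L i x))
    {x : UltraLp 𝕜 U κ p} (hx : UltraNonneg x) : UltraNonneg (ultraMap U L hL x) := by
  obtain ⟨g, hg, hgpos, rfl⟩ := hx
  exact ⟨_, bddFamily_of_le hg fun i => norm_apply_le_of_norm_le_one (hL i) _,
    fun i => hpos i _ (hgpos i), rfl⟩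

/-- The dilation, on an ultraproduct of finite-dimensional `ℓ^p` spaces. -/
theorem exists_ultraLp_dilation {𝕜 : Type*} [RCLike 𝕜] {Ω : Type u} [MeasurableSpace Ω]
    {μ : Measure Ω} {p : ℝ≥0∞} [Fact (1 ≤ p)] (hp : p ≠ ∞) (T : Lp 𝕜 p μ →L[𝕜] Lp 𝕜 p μ)
    (hTpos : LpPositive T) (hT : ‖T‖ ≤ 1) :
    ∃ (ι : Type u) (U : Ultrafilter ι) (κ : ι → Type u) (_ : ∀ i, Fintype (κ i))
      (S : UltraLp 𝕜 U κ p ≃ₗᵢ[𝕜] UltraLp 𝕜 U κ p) (D : Lp 𝕜 p μ →ₗᵢ[𝕜] UltraLp 𝕜 U κ p)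
      (P : UltraLp 𝕜 U κ p →L[𝕜] UltraLp 𝕜 U κ p),
      (∀ x, UltraNonneg x → UltraNonneg (S x)) ∧ (∀ f, LpNonneg f → UltraNonneg (D f)) ∧
      (∀ x, UltraNonneg x → UltraNonneg (P x)) ∧ (∀ x, P (P x) = P x) ∧ ‖P‖ ≤ 1 ∧
      ∀ (k : ℕ) f, D ((T ^ k) f) = P ((S ^ k) (D f)) := by
  classical
  let ι := Finset {A : Set Ω // MeasurableSet A ∧ μ A ≠ ∞} × ℕ
  let U : Ultrafilter ι := Ultrafilter.of atTop
  have hU : (U : Filter ι) ≤ atTop := Ultrafilter.of_le _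
  choose κ inst W V E K hW hVpos hEpos hEE hV hE hK hKV hfix hdil using
    fun i : ι => exists_approx_dilation hp T hTpos hT i.1 i.2
  have hKlim : ∀ f, Tendsto (fun i => K i f) U (𝓝 f) := by
    refine tendsto_of_fix_indicators hp hK fun A hA hAμ => hU ?_
    filter_upwards [eventually_ge_atTop (({⟨A, hA, hAμ⟩}, 0) : ι)] with i hi
    exact hfix i ⟨A, hA, hAμ⟩ (hi.1 (by simp))
  have hVlim : ∀ f, Tendsto (fun i => ‖V i f‖) U (𝓝 ‖f‖) := fun f =>
    tendsto_of_tendsto_of_tendsto_of_le_of_le (hKlim f).norm tendsto_const_nhds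
      (fun i => hKV i f) fun i => norm_apply_le_of_norm_le_one (hV i) f
  have hn : Tendsto (fun i : ι => 1 / ((i.2 : ℝ) + 1)) U (𝓝 0) := by
    have h1 : Tendsto (fun i : ι => i.2) atTop atTop := by
      rw [← prod_atTop_atTop_eq]; exact tendsto_snd
    exact (tendsto_one_div_add_atTop_nhds_zero_nat.comp h1).mono_left hU
  refine ⟨ι, U, κ, inst, ultraIso U W, ultraEmb U V hV hVlim, ultraMap U E hE, ?_, ?_,
    fun x => UltraNonneg.ultraMap hE hEpos, fun x => ?_, norm_ultraMap_le U E hE, fun k f => ?_⟩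
  · rintro _ ⟨g, hg, hgpos, rfl⟩
    exact ⟨_, bddFamily_of_le hg fun i => ((W i).norm_map _).le, fun i => hW i _ (hgpos i), rfl⟩
  · exact fun f hf => ⟨_, _, fun i => hVpos i f hf, rfl⟩
  · obtain ⟨g, hg, rfl⟩ := ultraMk_surjective U x
    have h1 := bddFamily_of_le hg fun i => norm_apply_le_of_norm_le_one (hE i) (g i)
    have h2 := bddFamily_of_le h1 fun i => norm_apply_le_of_norm_le_one (hE i) (E i (g i))
    rw [ultraMap_mk U E hE g hg h1, ultraMap_mk U E hE _ h1 h2]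
    simp only [hEE]
  · have hb : ∃ C, ∀ i, ‖V i f‖ ≤ C :=
      ⟨‖f‖, fun i => norm_apply_le_of_norm_le_one (hV i) f⟩
    have hb1 : ∃ C, ∀ i, ‖(W i ^ k) (V i f)‖ ≤ C := by simpa using hb
    have hb2 := bddFamily_of_le hb1 fun i => norm_apply_le_of_norm_le_one (hE i) ((W i ^ k) (V i f))
    have hb3 : ∃ C, ∀ i, ‖V i ((T ^ k) f)‖ ≤ C :=
      ⟨‖(T ^ k) f‖, fun i => norm_apply_le_of_norm_le_one (hV i) _⟩
    have h1 : ultraMap U E hE ((ultraIso U W ^ k) (ultraMk 𝕜 U (fun i => V i f) hb)) =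
        ultraMk 𝕜 U (fun i => E i ((W i ^ k) (V i f))) hb2 := by
      rw [ultraIso_pow_mk U W k _ hb hb1, ultraMap_mk U E hE _ hb1 hb2]
    change ultraMk 𝕜 U (fun i => V i ((T ^ k) f)) hb3 =
      ultraMap U E hE ((ultraIso U W ^ k) (ultraMk 𝕜 U (fun i => V i f) hb))
    rw [h1, eq_comm, ultraMk_eq_iff]
    refine squeeze_zero (fun i => norm_nonneg _) (fun i => hdil i k f) ?_
    have h2 : Tendsto (fun i : ι => 2 * (k : ℝ) / (i.2 + 1) * ‖f‖) U (𝓝 0) := by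
      have := (hn.const_mul (2 * (k : ℝ))).mul_const ‖f‖
      simpa [div_eq_mul_inv] using this
    have h3 : ∀ j, Tendsto (fun i : ι => ‖K i ((T ^ j) f) - (T ^ j) f‖ +
        1 / ((i.2 : ℝ) + 1) * ‖f‖) U (𝓝 0) := fun j => by
      have h4 := tendsto_iff_norm_sub_tendsto_zero.1 (hKlim ((T ^ j) f))
      simpa using h4.add (hn.mul_const ‖f‖)
    have h5 := h2.add (tendsto_finsetSum (Finset.range k) fun j _ => h3 j)
    simpa using h5

end Dilation

theorem mainTheorem2 {𝕜 : Type*} [RCLike 𝕜] {Ω : Type u} [MeasurableSpace Ω] (μ : Measure Ω)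
    (p : ℝ≥0∞) [Fact (1 ≤ p)] (hp : p ≠ ∞)
    (T : Lp 𝕜 p μ →L[𝕜] Lp 𝕜 p μ) (hTpos : LpPositive T) (hT : ‖T‖ ≤ 1) :
    ∃ (Ω' : Type u) (_ : MeasurableSpace Ω') (ν : Measure Ω')
      (S : Lp 𝕜 p ν ≃ₗᵢ[𝕜] Lp 𝕜 p ν)
      (D : Lp 𝕜 p μ →ₗᵢ[𝕜] Lp 𝕜 p ν)
      (P : Lp 𝕜 p ν →L[𝕜] Lp 𝕜 p ν),
      LpPositive S ∧ LpPositive D ∧ LpPositive P ∧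
      (∀ g : Lp 𝕜 p ν, P (P g) = P g) ∧ ‖P‖ ≤ 1 ∧
      ∀ (k : ℕ) (f : Lp 𝕜 p μ), D ((T ^ k) f) = P ((S ^ k) (D f)) := by
  obtain ⟨ι, U, κ, _, S, D, P, hS, hD, hP, hPP, hP1, hdil⟩ :=
    exists_ultraLp_dilation hp T hTpos hT
  obtain ⟨Ω', _, ν, Θ, hΘ⟩ := exists_lp_equiv_ultraLp (𝕜 := 𝕜) (κ := κ) U hp
  refine ⟨Ω', inferInstance, ν, (Θ.trans S).trans Θ.symm, Θ.symm.toLinearIsometry.comp D,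
    Θ.symm.toLinearIsometry.toContinuousLinearMap ∘L P ∘L
      Θ.toLinearIsometry.toContinuousLinearMap, fun f hf => ?_, fun f hf => ?_, fun f hf => ?_,
    fun g => ?_, ?_, fun k f => ?_⟩
  · rw [hΘ] at hf ⊢
    simpa using hS _ hf
  · rw [hΘ]
    simpa using hD _ hf
  · rw [hΘ] at hf ⊢
    simpa using hP _ hf
  · simp [hPP]
  · refine ContinuousLinearMap.opNorm_le_bound _ zero_le_one fun x => ?_
    simpa using norm_apply_le_of_norm_le_one hP1 (Θ x)
  · have hk : ∀ y, (((Θ.trans S).trans Θ.symm) ^ k) (Θ.symm y) = Θ.symm ((S ^ k) y) := by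
      intro y
      induction k with
      | zero => rfl
      | succ k ih => simp [pow_succ', LinearIsometryEquiv.coe_mul, ih]
    change Θ.symm (D ((T ^ k) f)) =
      Θ.symm (P (Θ ((((Θ.trans S).trans Θ.symm) ^ k) (Θ.symm (D f)))))
    rw [hk, Θ.apply_symm_apply, hdil]
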